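/- Let $R(x,y)=(x,-y)$, let $D\subset\mathbb R^2$ be open with $R(D)=D$, let $F=(F_1,F_2):D\to\mathbb R^2$ be of class $C^2$, and put $F^-=F$, $F^+=-R\circ F\circ R$. Let $\Gamma(t,z)$ be the local flow of $F$ in $D$ and $Y(t,z)=D_z\Gamma(t,z)$. Assume: $(h_1)$ there are $x_i<x_v$ such that $p_i=(x_i,0)$ and $p_v=(x_v,0)$ lie in $D$, $F_2(p_v)=F_2(p_i)=0$, $\frac{\partial F_2}{\partial x}(p_v)F_1(p_v)<0$, $\frac{\partial F_2}{\partial x}(p_i)F_1(p_i)>0$, and $F_2(x,0)\ne0$ for $x_i<x<x_v$; $(h_2)$ for each $x_i<x\le x_v$ the solution $\Gamma(t,(x,0))$ exists up to a time $\overline\sigma(x)>0$, satisfies $\Gamma_2(t,(x,0))<0$ for $0<t<\overline\sigma(x)$, and reaches $\Sigma=\{y=0\}$ transversely at $t=\overline\sigma(x)$, that is, $\Gamma_2(\overline\sigma(x),(x,0))=0$ and $F_2(\Gamma(\overline\sigma(x),(x,0)))\neq0$. Let $\varepsilon_0>0$, let $G^\pm(t,z)$ and $H^\pm(t,z;\varepsilon)$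 be $C^\infty$ functions with values in $\mathbb R^2$ on $\mathbb R\times D$ and $\mathbb R\times D\times(-\varepsilon_0,\varepsilon_0)$, and consider the Filippov system $$(x',y')=Z_\varepsilon(t,x,y)=X^\pm_\varepsilon(t,x,y)\ \text{ for } \pm y>0,\qquad X^\pm_\varepsilon(t,z)=F^\pm(z)+\varepsilon G^\pm(t,z)+\varepsilon^2H^\pm(t,z;\varepsilon).$$ For $\theta\in\mathbb R$ and $x\in(x_i,x_v]$ define the Melnikov function $$M(\theta,x)=F\big(\Gamma(\overline\sigma(x),(x,0))\big)\wedge\Big(Y(\overline\sigma(x),(x,0))\int_0^{\overline\sigma(x)}Y(t,(x,0))^{-1}\,\{G^-,G^+\}_\theta\big(t,\Gamma(t,(x,0))\big)\,dt\Big),$$ where $(a_1,a_2)\wedge(b_1,b_2)=-a_2b_1+a_1b_2$ and $\{G^-,G^+\}_\theta(t,z)=G^-(t+\theta,z)+R\,G^+(-t+\theta,Rz)$. Suppose that $Z_\varepsilon$ is autonomous for every $\varepsilon\in(-\varepsilon_0,\varepsilon_0)$; then $M(\theta,x)$ does not depend on $\theta$ and is denoted $M(x)$. If $x^*\in(x_i,x_v)$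 satisfies $M(x^*)=0$ and $M'(x^*)\neq0$, then there are $C>0$ and $\varepsilon_1\in(0,\varepsilon_0]$ such that for every $\varepsilon\in(0,\varepsilon_1)$ the system has a crossing periodic solution in $D$ whose initial condition is at distance at most $C\varepsilon$ from $(x^*,0)$. Here a crossing periodic solution is a periodic solution $u$ that follows $X^+_\varepsilon$ in $y>0$ and $X^-_\varepsilon$ in $y<0$, meets $\Sigma$, and meets it only at points of the crossing region, where the second components of $X^+_\varepsilon$ and $X^-_\varepsilon$ have the same nonzero sign and where $u$ passes from one zone to the other. -/

import Mathlib

open Set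
open scoped ContDiff

namespace TwoFold

/-- The involution `R(x, y) = (x, -y)` of the plane; its fixed set is the switching line `y = 0`. -/
def R (z : ℝ × ℝ) : ℝ × ℝ := (z.1, -z.2)

/-- The wedge product `(a₁, a₂) ∧ (b₁, b₂) = ⟨(-a₂, a₁), (b₁, b₂)⟩`. -/
def wedge (a b : ℝ × ℝ) : ℝ := -a.2 * b.1 + a.1 * b.2

/-- The field `F⁺(z) = -R F(R z)`; the field `F⁻` is `F` itself. -/
def reversed (F : ℝ × ℝ → ℝ × ℝ) (z : ℝ × ℝ) : ℝ × ℝ := -R (F (R z))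

/-- `u` solves `z' = F(z)` on the time set `J` and stays in the domain `D` of `F`. -/
def IsSolOn (F : ℝ × ℝ → ℝ × ℝ) (D : Set (ℝ × ℝ)) (J : Set ℝ) (u : ℝ → ℝ × ℝ) : Prop :=
  ∀ t ∈ J, u t ∈ D ∧ HasDerivWithinAt u (F (u t)) J t

/-- The solution of `w' = F(w)`, `w(0) = z`, exists in `D` at all times between `0` and `t`. -/
def InFlowDomain (F : ℝ × ℝ → ℝ × ℝ) (D : Set (ℝ × ℝ)) (t : ℝ) (z : ℝ × ℝ) : Prop :=
  ∃ u : ℝ → ℝ × ℝ, u 0 = z ∧ IsSolOn F D (uIcc 0 t) u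

open Classical in
/-- The local flow `Γ(t, z)` of `F` in `D`: the value at time `t` of the solution starting at `z`
(with the value `0` where that solution does not exist up to time `t`). -/
noncomputable def flow (F : ℝ × ℝ → ℝ × ℝ) (D : Set (ℝ × ℝ)) (t : ℝ) (z : ℝ × ℝ) : ℝ × ℝ :=
  if h : InFlowDomain F D t z then h.choose t else 0

/-- The fundamental matrix `Y(t, z) = D_z Γ(t, z)`. -/
noncomputable def fundamental (F : ℝ × ℝ → ℝ × ℝ) (D : Set (ℝ × ℝ)) (t : ℝ) (z : ℝ × ℝ) :
    ℝ × ℝ →L[ℝ] ℝ × ℝ :=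
  fderiv ℝ (fun w : ℝ × ℝ => flow F D t w) z

/-- Partial derivative `∂F₂/∂x` at `z`. -/
noncomputable def dxF2 (F : ℝ × ℝ → ℝ × ℝ) (z : ℝ × ℝ) : ℝ := (fderiv ℝ F z (1, 0)).2

/-- Hypothesis on the two folds: an invisible one at `(x_i, 0)`, a visible one at `(x_v, 0)`,
and no tangency in between. -/
structure FoldHyp (F : ℝ × ℝ → ℝ × ℝ) (D : Set (ℝ × ℝ)) (xi xv : ℝ) : Prop where
  lt : xi < xv
  mem_i : (xi, 0) ∈ D
  mem_v : (xv, 0) ∈ D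
  zero_v : (F (xv, 0)).2 = 0
  zero_i : (F (xi, 0)).2 = 0
  visible : dxF2 F (xv, 0) * (F (xv, 0)).1 < 0
  invisible : 0 < dxF2 F (xi, 0) * (F (xi, 0)).1
  ne_zero : ∀ x ∈ Ioo xi xv, (F (x, 0)).2 ≠ 0

/-- The solution of `z' = F(z)` from `(x, 0)` runs through `y < 0` for `0 < t < s` and reaches the
switching line transversely at time `s > 0`. -/
def ReachesAt (F : ℝ × ℝ → ℝ × ℝ) (D : Set (ℝ × ℝ)) (x s : ℝ) : Prop :=
  0 < s ∧ InFlowDomain F D s (x, 0) ∧ (∀ t ∈ Ioo 0 s, (flow F D t (x, 0)).2 < 0) ∧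
    (flow F D s (x, 0)).2 = 0 ∧ (F (flow F D s (x, 0))).2 ≠ 0

/-- Hypothesis on the return to the switching line. -/
def ReturnHyp (F : ℝ × ℝ → ℝ × ℝ) (D : Set (ℝ × ℝ)) (xi xv : ℝ) : Prop :=
  ∀ x ∈ Ioc xi xv, ∃ s : ℝ, ReachesAt F D x s

/-- The time `σ̄(x)` at which the solution from `(x, 0)` returns to the switching line. -/
noncomputable def returnTime (F : ℝ × ℝ → ℝ × ℝ) (D : Set (ℝ × ℝ)) (x : ℝ) : ℝ :=
  sInf {t : ℝ | 0 < t ∧ InFlowDomain F D t (x, 0) ∧ (flow F D t (x, 0)).2 = 0}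

/-- `{G⁻, G⁺}_θ(t, z) = G⁻(t + θ, z) + R G⁺(-t + θ, R z)`. -/
def bracket (Gm Gp : ℝ → ℝ × ℝ → ℝ × ℝ) (θ t : ℝ) (z : ℝ × ℝ) : ℝ × ℝ :=
  Gm (t + θ) z + R (Gp (-t + θ) (R z))

/-- The Melnikov function `M(θ, x)`. On `[0, σ̄(x)]` the unperturbed periodic orbit through
`(x, 0)` is `t ↦ Γ(t, (x, 0))`. -/
noncomputable def melnikov (F : ℝ × ℝ → ℝ × ℝ) (D : Set (ℝ × ℝ))
    (Gm Gp : ℝ → ℝ × ℝ → ℝ × ℝ) (θ x : ℝ) : ℝ :=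
  wedge (F (flow F D (returnTime F D x) (x, 0)))
    (fundamental F D (returnTime F D x) (x, 0)
      (∫ t in (0 : ℝ)..returnTime F D x,
        (fundamental F D t (x, 0)).inverse (bracket Gm Gp θ t (flow F D t (x, 0)))))

/-- The perturbed field `F(z) + ε G(t, z) + ε² H(t, z; ε)` of one zone. -/
def perturbed (F : ℝ × ℝ → ℝ × ℝ) (G : ℝ → ℝ × ℝ → ℝ × ℝ) (H : ℝ → ℝ × ℝ → ℝ → ℝ × ℝ)
    (ε t : ℝ) (z : ℝ × ℝ) : ℝ × ℝ :=
  F z + ε • G t z + ε ^ 2 • H t z ε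

/-- The system equal to `Xp` for `y > 0` and to `Xm` for `y < 0` does not depend on time. -/
def IsAutonomous (D : Set (ℝ × ℝ)) (Xp Xm : ℝ → ℝ × ℝ → ℝ × ℝ) : Prop :=
  ∀ s t : ℝ, ∀ z ∈ D, (0 < z.2 → Xp s z = Xp t z) ∧ (z.2 < 0 → Xm s z = Xm t z)

/-- `u` is a global solution in `D` of the Filippov system equal to `Xp` for `y > 0` and to `Xm`
for `y < 0`, and it meets the line `y = 0` only at points of the crossing region, where it passes
from one zone to the other. -/
structure IsCrossingSolution (D : Set (ℝ × ℝ)) (Xp Xm : ℝ → ℝ × ℝ → ℝ × ℝ)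
    (u : ℝ → ℝ × ℝ) : Prop where
  mem : ∀ t, u t ∈ D
  upper : ∀ t, 0 < (u t).2 → HasDerivAt u (Xp t (u t)) t
  lower : ∀ t, (u t).2 < 0 → HasDerivAt u (Xm t (u t)) t
  crossing : ∀ t, (u t).2 = 0 → 0 < (Xp t (u t)).2 * (Xm t (u t)).2
  cross_up : ∀ t, (u t).2 = 0 → 0 < (Xp t (u t)).2 →
    HasDerivWithinAt u (Xm t (u t)) (Iic t) t ∧ HasDerivWithinAt u (Xp t (u t)) (Ici t) t
  cross_down : ∀ t, (u t).2 = 0 → (Xp t (u t)).2 < 0 →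
    HasDerivWithinAt u (Xp t (u t)) (Iic t) t ∧ HasDerivWithinAt u (Xm t (u t)) (Ici t) t

/-- A crossing periodic solution: it is periodic and does meet the switching line. -/
def IsCrossingPeriodicSolution (D : Set (ℝ × ℝ)) (Xp Xm : ℝ → ℝ × ℝ → ℝ × ℝ)
    (u : ℝ → ℝ × ℝ) : Prop :=
  IsCrossingSolution D Xp Xm u ∧ (∃ T : ℝ, 0 < T ∧ Function.Periodic u T) ∧ ∃ t, (u t).2 = 0

end TwoFold

open Filter Topology Metric
open scoped NNReal

/-! Reflecting the upper zone by `R` and reversing time turns the upper field into a second field on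
`y ≤ 0`. For `ε = 0` this field and the lower one are both `F`. Near `xs`, each of the two
autonomous fields carries `(x, 0)` through `y < 0` back to the switching line, at abscissas `P₁ (x,
ε)` and `P₂ (x, ε)`. If `P₁ (x, ε) = P₂ (x, ε)`, then following the lower arc forwards and the
reflected second arc backwards closes up to a crossing periodic orbit
(`exists_isCrossingPeriodicSolution`). It remains to find zeros of `d = P₁ - P₂`.

Since both fields are `F` at `ε = 0`, `d (x, 0) = 0`, so `d (x, ε) = ε e(x) + O(ε²)`. Variation of
constants, with the return time eliminated through the condition `y = 0` (`exists_halfReturn`),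
gives `∂P/∂ε · F₂` at the landing point as minus the wedge of `F` with `Y ∫ Y⁻¹ ∂X/∂ε`. Subtracting
the two formulas produces the integrand `G⁻ + R G⁺ R`, that is, the bracket once autonomy has
removed its time arguments. Hence `M = -e b`, where `b` is the second component of `F` at the
landing point and is positive at `xs`. A simple zero of `M` is therefore a simple zero of `e`, and
the intermediate value theorem on an interval of radius `C ε` yields a zero of `d (·, ε)`
(`exists_zero_of_simple_zero`).

The analytic input is that the half-return maps are `C²` jointly in `(x, ε)`. For this the parameter
becomes an extra coordinate with zero velocity, the field is cut off outside a neighbourhood of the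
given orbit, and its global flow is shown to be `C²` (`exists_isFlow_contDiff_two`). The implicit
function theorem then gives the hitting time (`exists_hit_time`). -/

namespace TwoFold

/-! ### Global solutions of globally Lipschitz equations -/

section GlobalFlow

variable {E : Type*} [NormedAddCommGroup E] [NormedSpace ℝ E]

/-- Grönwall's inequality in both time directions. -/
theorem norm_le_gronwallBound_abs {u u' : ℝ → E} {K B T : ℝ}
    (hu : ∀ t ∈ Ioo (-T) T, HasDerivAt u (u' t) t)
    (hb : ∀ t ∈ Ioo (-T) T, ‖u' t‖ ≤ K * ‖u t‖ + B) {t : ℝ} (ht : t ∈ Ioo (-T) T) :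
    ‖u t‖ ≤ gronwallBound ‖u 0‖ K B |t| := by
  rcases le_total 0 t with h | h
  · have hsub : Icc 0 t ⊆ Ioo (-T) T := fun s hs => ⟨by linarith [hs.1, ht.2, ht.1], by
      linarith [hs.2, ht.2]⟩
    have := norm_le_gronwallBound_of_norm_deriv_right_le (f := u) (f' := u') (a := 0) (b := t)
      (fun s hs => (hu s (hsub hs)).continuousAt.continuousWithinAt)
      (fun s hs => (hu s (hsub (Ico_subset_Icc_self hs))).hasDerivWithinAt) le_rfl
      (fun s hs => hb s (hsub (Ico_subset_Icc_self hs))) t ⟨h, le_rfl⟩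
    simpa [abs_of_nonneg h] using this
  · have hsub : ∀ s ∈ Icc 0 (-t), -s ∈ Ioo (-T) T := fun s hs => ⟨by linarith [hs.2, ht.1], by
      linarith [hs.1, ht.2, ht.1]⟩
    have hd : ∀ s ∈ Icc 0 (-t), HasDerivAt (fun s => u (-s)) (-u' (-s)) s := fun s hs => by
      simpa [Function.comp_def] using (hu _ (hsub s hs)).scomp s (hasDerivAt_neg s)
    have := norm_le_gronwallBound_of_norm_deriv_right_le (f := fun s => u (-s))
      (f' := fun s => -u' (-s)) (a := 0) (b := -t)
      (fun s hs => (hd s hs).continuousAt.continuousWithinAt)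
      (fun s hs => (hd s (Ico_subset_Icc_self hs)).hasDerivWithinAt) le_rfl
      (fun s hs => by simpa using hb _ (hsub s (Ico_subset_Icc_self hs))) (-t) ⟨by linarith, le_rfl⟩
    simpa [abs_of_nonpos h] using this

/-- The identity times a bump function. Precomposing a field with `π` makes it bounded, and `‖π x‖ ≤
‖x‖` preserves its linear growth estimate. -/
theorem exists_lipschitz_truncation [FiniteDimensional ℝ E] {N : ℝ} (hN : 0 < N) :
    ∃ (π : E → E) (K : ℝ≥0) (M : ℝ), LipschitzWith K π ∧ (∀ x, ‖x‖ ≤ N → π x = x) ∧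
      (∀ x, ‖π x‖ ≤ ‖x‖) ∧ (∀ x, ‖π x‖ ≤ M) := by
  let χ : ContDiffBump (0 : E) := ⟨N, N + 1, hN, by linarith⟩
  have hcs : HasCompactSupport fun x : E => χ x • x := χ.hasCompactSupport.smul_right
  have hcd : ContDiff ℝ 1 fun x : E => χ x • x := χ.contDiff.smul contDiff_id
  obtain ⟨K, hK⟩ := ContDiff.lipschitzWith_of_hasCompactSupport hcs hcd one_ne_zero
  obtain ⟨M, hM⟩ := hcs.exists_bound_of_continuous hcd.continuous
  refine ⟨fun x => χ x • x, K, M, hK, fun x hx => ?_, fun x => ?_, hM⟩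
  · have : χ x = 1 := χ.one_of_mem_closedBall (by simpa using hx)
    simp [this]
  · rw [norm_smul, Real.norm_of_nonneg χ.nonneg]
    exact mul_le_of_le_one_left (norm_nonneg _) χ.le_one

/-- `Φ` is the global flow of the autonomous field `W`. -/
structure IsFlow (W : E → E) (Φ : ℝ → E → E) : Prop where
  zero : ∀ p, Φ 0 p = p
  deriv : ∀ t p, HasDerivAt (fun s => Φ s p) (W (Φ t p)) t

variable [FiniteDimensional ℝ E]

/-- Picard–Lindelöf covers the whole interval for the truncated equation, whose field is bounded
there. Grönwall keeps that solution in the ball where `π` is the identity, so it solves the original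
equation. -/
theorem exists_solution_Ioo {f : ℝ → E → E} {K : ℝ≥0} (hf : ∀ t, LipschitzWith K (f t))
    (hc : ∀ x, Continuous fun t => f t x) (x₀ : E) {T : ℝ} (hT : 0 < T) :
    ∃ u : ℝ → E, u 0 = x₀ ∧ ∀ t ∈ Ioo (-T) T, HasDerivAt u (f t (u t)) t := by
  have : CompleteSpace E := FiniteDimensional.complete ℝ E
  obtain ⟨B, hB⟩ := isCompact_Icc.exists_bound_of_continuousOn
    (s := Icc (-T) T) (hc 0).continuousOn
  have hB0 : 0 ≤ B := (norm_nonneg _).trans (hB 0 ⟨by linarith, hT.le⟩)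
  have hfb : ∀ t ∈ Icc (-T) T, ∀ x, ‖f t x‖ ≤ K * ‖x‖ + B := fun t ht x => by
    have h1 := (hf t).norm_sub_le x 0
    have h2 := norm_sub_norm_le (f t x) (f t 0)
    have := hB t ht
    rw [sub_zero] at h1
    linarith
  set N := gronwallBound ‖x₀‖ K B T + 1
  have hg : ∀ t, |t| ≤ T → gronwallBound ‖x₀‖ K B |t| ≤ N := fun t ht =>
    ((gronwallBound_mono (norm_nonneg _) hB0 K.2) ht).trans (by simp [N])
  have hN : 0 < N := by
    have : gronwallBound ‖x₀‖ K B 0 ≤ gronwallBound ‖x₀‖ K B T :=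
      (gronwallBound_mono (norm_nonneg _) hB0 K.2) hT.le
    rw [gronwallBound_x0] at this
    have := norm_nonneg x₀
    simp only [N]; linarith
  obtain ⟨π, Kπ, M, hπ, hid, hle, hM⟩ := exists_lipschitz_truncation (E := E) hN
  have hM0 : 0 ≤ M := (norm_nonneg _).trans (hM 0)
  let L : ℝ≥0 := ⟨K * M + B, by positivity⟩
  let T' : ℝ≥0 := ⟨T, hT.le⟩
  let t₀ : Icc (-T) T := ⟨0, by linarith, hT.le⟩
  have hPL : IsPicardLindelof (fun t x => f t (π x)) t₀ x₀ (L * T') 0 L (K * Kπ) := by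
    refine ⟨fun t _ => ((hf t).comp hπ).lipschitzOnWith, fun x _ => (hc _).continuousOn,
      fun t ht x _ => (hfb t ht _).trans ?_, ?_⟩
    · show _ ≤ (K * M + B : ℝ)
      gcongr
      exact hM x
    · simp [t₀, T']
      exact le_of_eq rfl
  obtain ⟨u, hu0, hu⟩ := hPL.exists_eq_forall_mem_Icc_hasDerivWithinAt₀
  have hu0 : u 0 = x₀ := hu0
  have hu' : ∀ t ∈ Ioo (-T) T, HasDerivAt u (f t (π (u t))) t := fun t ht =>
    (hu t (Ioo_subset_Icc_self ht)).hasDerivAt (Icc_mem_nhds ht.1 ht.2)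
  refine ⟨u, hu0, fun t ht => ?_⟩
  have h1 := norm_le_gronwallBound_abs hu' (fun t ht =>
    (hfb t (Ioo_subset_Icc_self ht) _).trans (by gcongr; exact hle _)) ht
  rw [hu0] at h1
  have h2 := hu' t ht
  rwa [hid _ (h1.trans (hg t (abs_le.2 ⟨ht.1.le, ht.2.le⟩)))] at h2

theorem exists_global_solution {f : ℝ → E → E} {K : ℝ≥0} (hf : ∀ t, LipschitzWith K (f t))
    (hc : ∀ x, Continuous fun t => f t x) (x₀ : E) :
    ∃ u : ℝ → E, u 0 = x₀ ∧ ∀ t, HasDerivAt u (f t (u t)) t := by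
  have hpos : ∀ n : ℕ, (0 : ℝ) < n + 1 := fun n => by positivity
  choose u hu0 hu using fun n : ℕ => exists_solution_Ioo hf hc x₀ (hpos n)
  have huniq : ∀ m n : ℕ, m ≤ n → ∀ t ∈ Ioo (-(m + 1 : ℝ)) (m + 1), u m t = u n t := by
    intro m n hmn t ht
    have hmn' : (m : ℝ) ≤ n := by exact_mod_cast hmn
    refine ODE_solution_unique_of_mem_Ioo (v := f) (s := fun _ => univ) (K := K) (t₀ := 0)
      (fun t _ => (hf t).lipschitzOnWith) (by constructor <;> linarith [hpos m])
      (fun t ht => ⟨hu m t ht, trivial⟩)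
      (fun t ht => ⟨hu n t ⟨by linarith [ht.1], by linarith [ht.2]⟩, trivial⟩) ?_ ht
    rw [hu0, hu0]
  have hmem : ∀ t : ℝ, t ∈ Ioo (-((⌈|t|⌉₊ : ℝ) + 1)) (⌈|t|⌉₊ + 1) := fun t => by
    have := abs_le.1 (Nat.le_ceil |t|)
    constructor <;> linarith [this.1, this.2]
  have heq : ∀ n : ℕ, ∀ t ∈ Ioo (-(n + 1 : ℝ)) (n + 1), u ⌈|t|⌉₊ t = u n t := fun n t ht => by
    rcases le_total ⌈|t|⌉₊ n with h | h
    · exact huniq _ _ h t (hmem t)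
    · exact (huniq _ _ h t ht).symm
  refine ⟨fun t => u ⌈|t|⌉₊ t, hu0 _, fun t => ?_⟩
  refine (hu _ t (hmem t)).congr_of_eventuallyEq ?_
  filter_upwards [Ioo_mem_nhds (hmem t).1 (hmem t).2] with s hs
  exact heq _ s hs

theorem exists_isFlow {W : E → E} {K : ℝ≥0} (hW : LipschitzWith K W) :
    ∃ Φ : ℝ → E → E, IsFlow W Φ := by
  choose Φ h0 h1 using fun p => exists_global_solution (f := fun _ => W) (fun _ => hW)
    (fun _ => continuous_const) p
  exact ⟨fun t p => Φ p t, h0, fun t p => h1 p t⟩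

end GlobalFlow

/-! ### Smooth dependence of a flow on time and initial condition -/

theorem gronwallBound_zero_eq_mul (K ε x : ℝ) :
    gronwallBound 0 K ε x = ε * gronwallBound 0 K 1 x := by
  by_cases hK : K = 0
  · simp [hK, gronwallBound_K0]
  · simp only [gronwallBound_of_K_ne_0 hK]
    ring

theorem continuous_uncurry_of_locally_uniform {E G : Type*} [NormedAddCommGroup E]
    [NormedAddCommGroup G]
    {g : ℝ → E → G} (ht : ∀ p, Continuous fun t => g t p)
    (hp : ∀ T q, ∀ η > 0, ∃ ρ > 0, ∀ t ∈ Ioo (-T) T, ∀ p, ‖p - q‖ < ρ → ‖g t p - g t q‖ ≤ η) :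
    Continuous fun x : ℝ × E => g x.1 x.2 := by
  rw [continuous_iff_continuousAt]
  rintro ⟨t₀, p₀⟩
  rw [Metric.continuousAt_iff']
  intro η hη
  obtain ⟨ρ, hρ, h⟩ := hp (|t₀| + 1) p₀ (η / 2) (by positivity)
  have h1 : ∀ᶠ x : ℝ × E in 𝓝 (t₀, p₀), x.1 ∈ Ioo (-(|t₀| + 1)) (|t₀| + 1) :=
    continuousAt_fst.eventually (Ioo_mem_nhds (by linarith [neg_abs_le t₀])
      (by linarith [le_abs_self t₀]))
  have h2 : ∀ᶠ x : ℝ × E in 𝓝 (t₀, p₀), ‖x.2 - p₀‖ < ρ := by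
    have : ContinuousAt (fun x : ℝ × E => x.2) (t₀, p₀) := continuousAt_snd
    simpa [dist_eq_norm] using Metric.continuousAt_iff'.1 this ρ hρ
  have h3 : ∀ᶠ x : ℝ × E in 𝓝 (t₀, p₀), ‖g x.1 p₀ - g t₀ p₀‖ < η / 2 := by
    have h4 : ContinuousAt (fun x : ℝ × E => g x.1 p₀) (t₀, p₀) :=
      ((ht p₀).comp continuous_fst).continuousAt
    simpa [dist_eq_norm] using Metric.continuousAt_iff'.1 h4 (η / 2) (by positivity)
  filter_upwards [h1, h2, h3] with x h1 h2 h3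
  rw [dist_eq_norm]
  calc ‖g x.1 x.2 - g t₀ p₀‖ = ‖(g x.1 x.2 - g x.1 p₀) + (g x.1 p₀ - g t₀ p₀)‖ := by
        congr 1; abel
    _ ≤ ‖g x.1 x.2 - g x.1 p₀‖ + ‖g x.1 p₀ - g t₀ p₀‖ := norm_add_le _ _
    _ < η := by linarith [h x.1 h1 x.2 h2]

section SmoothFlow

variable {E : Type*} [NormedAddCommGroup E] [NormedSpace ℝ E]

variable {W : E → E} {Φ : ℝ → E → E} {K : ℝ≥0}

theorem IsFlow.norm_sub_le (h : IsFlow W Φ) (hW : LipschitzWith K W) (t : ℝ) (p q : E) :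
    ‖Φ t p - Φ t q‖ ≤ ‖p - q‖ * Real.exp (K * |t|) := by
  have := norm_le_gronwallBound_abs (T := |t| + 1) (K := K) (B := 0)
    (fun s _ => (h.deriv s p).sub (h.deriv s q))
    (fun s _ => by simpa using hW.norm_sub_le (Φ s p) (Φ s q)) (t := t)
    ⟨by linarith [neg_abs_le t], by linarith [le_abs_self t]⟩
  simpa [gronwallBound_ε0, h.zero] using this

theorem IsFlow.continuous (h : IsFlow W Φ) (hW : LipschitzWith K W) :
    Continuous fun x : ℝ × E => Φ x.1 x.2 := by
  refine continuous_uncurry_of_locally_uniform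
    (fun p => continuous_iff_continuousAt.2 fun t => (h.deriv t p).continuousAt) ?_
  intro T q η hη
  refine ⟨η / Real.exp (K * |T|), by positivity, fun t ht p hp => ?_⟩
  refine (h.norm_sub_le hW t p q).trans ?_
  rw [lt_div_iff₀ (Real.exp_pos _)] at hp
  refine le_trans ?_ hp.le
  have : |t| ≤ |T| := (abs_lt.2 ht).le.trans (le_abs_self T)
  gcongr

/-- `V` is the fundamental solution of the equation of first variation along the flow `Φ`. -/
structure IsVariation (W : E → E) (Φ : ℝ → E → E) (V : ℝ → E → E →L[ℝ] E) : Prop where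
  zero : ∀ p, V 0 p = ContinuousLinearMap.id ℝ E
  deriv : ∀ t p, HasDerivAt (fun s => V s p) ((fderiv ℝ W (Φ t p)).comp (V t p)) t

theorem IsVariation.norm_le {V : ℝ → E → E →L[ℝ] E} (hV : IsVariation W Φ V)
    (hW : LipschitzWith K W) (t : ℝ) (p : E) : ‖V t p‖ ≤ Real.exp (K * |t|) := by
  have := norm_le_gronwallBound_abs (T := |t| + 1) (K := K) (B := 0)
    (fun s _ => hV.deriv s p)
    (fun s _ => by
      rw [add_zero]
      refine (ContinuousLinearMap.opNorm_comp_le _ _).trans ?_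
      gcongr
      exact norm_fderiv_le_of_lipschitz ℝ hW) (t := t)
    ⟨by linarith [neg_abs_le t], by linarith [le_abs_self t]⟩
  rw [gronwallBound_ε0, hV.zero] at this
  refine this.trans (mul_le_of_le_one_left (Real.exp_pos _).le ContinuousLinearMap.norm_id_le)

/-- The difference of two variations starts at zero and solves a linear equation whose forcing is
controlled by the difference of `fderiv ℝ W` along the two orbits. Uniform continuity makes the
forcing small, and Grönwall transfers this to the difference. -/
theorem IsFlow.continuous_variation {V : ℝ → E → E →L[ℝ] E} (h : IsFlow W Φ)
    (hV : IsVariation W Φ V) (hW : LipschitzWith K W) (hu : UniformContinuous (fderiv ℝ W)) :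
    Continuous fun x : ℝ × E => V x.1 x.2 := by
  refine continuous_uncurry_of_locally_uniform
    (fun p => continuous_iff_continuousAt.2 fun t => (hV.deriv t p).continuousAt) ?_
  intro T q η hη
  rcases le_or_gt T 0 with hT | hT
  · exact ⟨1, one_pos, fun t ht => absurd (ht.1.trans ht.2) (by linarith)⟩
  set c := Real.exp (K * T) * gronwallBound 0 K 1 T with hc
  have hgm := gronwallBound_mono (δ := 0) (K := K) (ε := 1) le_rfl zero_le_one K.2
  have hg0 : 0 ≤ gronwallBound 0 K 1 T := by
    simpa [gronwallBound_x0] using hgm hT.le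
  have hc0 : 0 ≤ c := by positivity
  obtain ⟨ρ, hρ, hρ'⟩ := Metric.uniformContinuous_iff.1 hu (η / (c + 1)) (by positivity)
  refine ⟨ρ / Real.exp (K * T), by positivity, fun t ht p hp => ?_⟩
  rw [lt_div_iff₀ (Real.exp_pos _)] at hp
  have hexp : ∀ s ∈ Ioo (-T) T, Real.exp (K * |s|) ≤ Real.exp (K * T) := fun s hs => by
    have := (abs_lt.2 hs).le
    gcongr
  have hA : ∀ s ∈ Ioo (-T) T,
      ‖fderiv ℝ W (Φ s p) - fderiv ℝ W (Φ s q)‖ ≤ η / (c + 1) := fun s hs => by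
    rw [← dist_eq_norm]
    refine (hρ' ?_).le
    rw [dist_eq_norm]
    refine lt_of_le_of_lt (h.norm_sub_le hW s p q) (lt_of_le_of_lt ?_ hp)
    exact mul_le_mul_of_nonneg_left (hexp s hs) (norm_nonneg _)
  have := norm_le_gronwallBound_abs (T := T) (K := K)
    (B := η / (c + 1) * Real.exp (K * T))
    (fun s _ => (hV.deriv s p).sub (hV.deriv s q))
    (fun s hs => by
      have e : (fderiv ℝ W (Φ s p)).comp (V s p) - (fderiv ℝ W (Φ s q)).comp (V s q)
          = (fderiv ℝ W (Φ s p)).comp (V s p - V s q)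
            + (fderiv ℝ W (Φ s p) - fderiv ℝ W (Φ s q)).comp (V s q) := by
        ext v; simp
      rw [e]
      refine (norm_add_le _ _).trans (add_le_add ?_ ?_)
      · refine (ContinuousLinearMap.opNorm_comp_le _ _).trans ?_
        gcongr
        · exact norm_fderiv_le_of_lipschitz ℝ hW
        · exact le_rfl
      · refine (ContinuousLinearMap.opNorm_comp_le _ _).trans ?_
        gcongr
        · exact hA s hs
        · exact (hV.norm_le hW s q).trans (hexp s hs)) ht
  simp only [Pi.sub_apply, hV.zero, sub_self, norm_zero] at this
  rw [gronwallBound_zero_eq_mul] at this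
  refine this.trans ?_
  calc η / (c + 1) * Real.exp (K * T) * gronwallBound 0 K 1 |t|
      ≤ η / (c + 1) * Real.exp (K * T) * gronwallBound 0 K 1 T := by
        gcongr
        exact hgm (abs_lt.2 ht).le
    _ = η * (c / (c + 1)) := by rw [hc]; ring
    _ ≤ η := mul_le_of_le_one_right hη.le ((div_le_one (by positivity)).2 (by linarith))

theorem norm_sub_sub_fderiv_le_of_uniformContinuous (hd : Differentiable ℝ W)
    (hu : UniformContinuous (fderiv ℝ W)) {η : ℝ} (hη : 0 < η) :
    ∃ ρ > 0, ∀ a b, ‖a - b‖ < ρ → ‖W a - W b - fderiv ℝ W b (a - b)‖ ≤ η * ‖a - b‖ := by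
  obtain ⟨ρ, hρ, hρ'⟩ := Metric.uniformContinuous_iff.1 hu η hη
  refine ⟨ρ, hρ, fun a b hab => ?_⟩
  refine (convex_ball b ρ).norm_image_sub_le_of_norm_fderiv_le' (𝕜 := ℝ) (fun x _ => hd x)
    (fun x hx => ?_) (mem_ball_self hρ) (by simpa [dist_eq_norm] using hab)
  rw [← dist_eq_norm]
  exact (hρ' (by simpa using hx)).le

/-- The remainder `Φ s (q + v) - Φ s q - V s q v` starts at zero and satisfies the variational
equation up to a forcing bounded by a small multiple of `‖v‖`, so Grönwall makes it `o(‖v‖)`. -/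
theorem IsFlow.hasFDerivAt {V : ℝ → E → E →L[ℝ] E} (h : IsFlow W Φ)
    (hV : IsVariation W Φ V) (hW : LipschitzWith K W) (hd : Differentiable ℝ W)
    (hu : UniformContinuous (fderiv ℝ W)) (t : ℝ) (q : E) : HasFDerivAt (Φ t) (V t q) q := by
  rw [hasFDerivAt_iff_isLittleO_nhds_zero, Asymptotics.isLittleO_iff]
  intro η hη
  set T := |t| + 1
  have hT : 0 < T := by positivity
  have ht : t ∈ Ioo (-T) T := ⟨by linarith [neg_abs_le t], by linarith [le_abs_self t]⟩
  set c := Real.exp (K * T) * gronwallBound 0 K 1 |t| with hc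
  have hgm := gronwallBound_mono (δ := 0) (K := K) (ε := 1) le_rfl zero_le_one K.2
  have hg0 : 0 ≤ gronwallBound 0 K 1 |t| := by
    simpa [gronwallBound_x0] using hgm (abs_nonneg t)
  have hc0 : 0 ≤ c := by positivity
  obtain ⟨ρ, hρ, hρ'⟩ :=
    norm_sub_sub_fderiv_le_of_uniformContinuous hd hu (η := η / (c + 1)) (by positivity)
  have hnear : ∀ᶠ v : E in 𝓝 0, ‖v‖ < ρ / Real.exp (K * T) := by
    have := ball_mem_nhds (0 : E) (ε := ρ / Real.exp (K * T)) (by positivity)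
    filter_upwards [this] with v hv
    simpa using hv
  filter_upwards [hnear] with v hv
  rw [lt_div_iff₀ (Real.exp_pos _)] at hv
  have hΦ : ∀ s ∈ Ioo (-T) T, ‖Φ s (q + v) - Φ s q‖ ≤ ‖v‖ * Real.exp (K * T) := fun s hs => by
    have := h.norm_sub_le hW s (q + v) q
    rw [add_sub_cancel_left] at this
    refine this.trans ?_
    have := (abs_lt.2 hs).le
    gcongr
  have := norm_le_gronwallBound_abs (T := T) (K := K)
    (u := fun s => Φ s (q + v) - Φ s q - V s q v)
    (B := η / (c + 1) * (‖v‖ * Real.exp (K * T)))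
    (fun s _ => ((h.deriv s (q + v)).sub (h.deriv s q)).sub
      ((hV.deriv s q).clm_apply (hasDerivAt_const s v)))
    (fun s hs => by
      have e : W (Φ s (q + v)) - W (Φ s q)
            - (((fderiv ℝ W (Φ s q)).comp (V s q)) v + (V s q) 0)
          = fderiv ℝ W (Φ s q) (Φ s (q + v) - Φ s q - V s q v)
            + (W (Φ s (q + v)) - W (Φ s q) - fderiv ℝ W (Φ s q) (Φ s (q + v) - Φ s q)) := by
        simp
      rw [e]
      refine (norm_add_le _ _).trans (add_le_add ?_ ?_)
      · refine (ContinuousLinearMap.le_opNorm _ _).trans ?_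
        gcongr
        exact norm_fderiv_le_of_lipschitz ℝ hW
      · refine (hρ' _ _ (lt_of_le_of_lt (hΦ s hs) hv)).trans ?_
        gcongr
        exact hΦ s hs) ht
  simp only [hV.zero, h.zero, add_sub_cancel_left,
    ContinuousLinearMap.id_apply, sub_self, norm_zero] at this
  rw [gronwallBound_zero_eq_mul] at this
  refine this.trans ?_
  calc η / (c + 1) * (‖v‖ * Real.exp (K * T)) * gronwallBound 0 K 1 |t|
    _ = η * (c / (c + 1)) * ‖v‖ := by rw [hc]; ring
    _ ≤ η * ‖v‖ := by
      gcongr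
      exact mul_le_of_le_one_right hη.le ((div_le_one (by positivity)).2 (by linarith))

variable [FiniteDimensional ℝ E]

theorem IsFlow.exists_isVariation (h : IsFlow W Φ) (hW : LipschitzWith K W)
    (hc : Continuous (fderiv ℝ W)) : ∃ V : ℝ → E → E →L[ℝ] E, IsVariation W Φ V := by
  choose V h0 h1 using fun p => exists_global_solution
    (f := fun t (X : E →L[ℝ] E) => (fderiv ℝ W (Φ t p)).comp X) (K := K)
    (fun t => by
      refine LipschitzWith.of_dist_le_mul fun X Y => ?_
      rw [dist_eq_norm, dist_eq_norm, ← ContinuousLinearMap.comp_sub]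
      refine (ContinuousLinearMap.opNorm_comp_le _ _).trans ?_
      gcongr
      exact norm_fderiv_le_of_lipschitz ℝ hW)
    (fun X => by
      have : Continuous fun t => Φ t p :=
        continuous_iff_continuousAt.2 fun t => (h.deriv t p).continuousAt
      exact (hc.comp this).clm_comp continuous_const) (ContinuousLinearMap.id ℝ E)
  exact ⟨fun t p => V p t, h0, fun t p => h1 p t⟩

/-- The joint derivative of the flow is built from `W ∘ Φ` in time and `V` in space. If both are
`C^n`, the flow gains one order. -/
theorem IsFlow.contDiff_succ {V : ℝ → E → E →L[ℝ] E} (h : IsFlow W Φ)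
    (hV : IsVariation W Φ V) (hW : LipschitzWith K W) (hd : Differentiable ℝ W)
    (hu : UniformContinuous (fderiv ℝ W)) {n : ℕ} (hWn : ContDiff ℝ n W)
    (hΦn : ContDiff ℝ n fun x : ℝ × E => Φ x.1 x.2)
    (hVn : ∀ v, ContDiff ℝ n fun x : ℝ × E => V x.1 x.2 v) :
    ContDiff ℝ (n + 1) fun x : ℝ × E => Φ x.1 x.2 := by
  rw [contDiff_succ_iff_hasFDerivAt]
  refine ⟨fun x => (ContinuousLinearMap.toSpanSingleton ℝ (W (Φ x.1 x.2))).coprod (V x.1 x.2),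
    ?_, fun x => ?_⟩
  · rw [contDiff_clm_apply_iff]
    rintro ⟨s, v⟩
    simp only [ContinuousLinearMap.coprod_apply, ContinuousLinearMap.toSpanSingleton_apply]
    exact (contDiff_const.smul (hWn.comp hΦn)).add (hVn v)
  · exact (hasStrictFDerivAt_uncurry_coprod (f := Φ)
      (f₁ := fun t p => ContinuousLinearMap.toSpanSingleton ℝ (W (Φ t p))) (f₂ := V)
      (Eventually.of_forall fun v => (h.deriv v.1 v.2).hasFDerivAt)
      (Eventually.of_forall fun v => h.hasFDerivAt hV hW hd hu v.1 v.2)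
      (by
        have : Continuous fun x : ℝ × E =>
            ContinuousLinearMap.toSpanSingleton ℝ (W (Φ x.1 x.2)) := by
          rw [← contDiff_zero (𝕜 := ℝ), contDiff_clm_apply_iff]
          intro s
          simp only [ContinuousLinearMap.toSpanSingleton_apply]
          exact contDiff_const.smul
            (contDiff_zero.2 (hd.continuous.comp (h.continuous hW)))
        exact this.continuousAt)
      (h.continuous_variation hV hW hu).continuousAt).hasFDerivAt

theorem IsFlow.contDiff_one (h : IsFlow W Φ) (hW1 : ContDiff ℝ 1 W)
    (hs : HasCompactSupport W) : ContDiff ℝ 1 fun x : ℝ × E => Φ x.1 x.2 := by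
  obtain ⟨K, hW⟩ := ContDiff.lipschitzWith_of_hasCompactSupport hs hW1 one_ne_zero
  have hu : UniformContinuous (fderiv ℝ W) :=
    (hs.fderiv ℝ).uniformContinuous_of_continuous (hW1.continuous_fderiv one_ne_zero)
  obtain ⟨V, hV⟩ := h.exists_isVariation hW (hW1.continuous_fderiv one_ne_zero)
  have := h.contDiff_succ hV hW (hW1.differentiable one_ne_zero) hu (n := 0)
    (contDiff_zero.2 hW1.continuous) (contDiff_zero.2 (h.continuous hW)) (fun v =>
      contDiff_zero.2 ((h.continuous_variation hV hW hu).clm_apply continuous_const))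
  simpa using this

/-- The pair `(Φ, V v)` is itself an orbit of the field `(p, w) ↦ (W p, DW(p) w)`, which is `C¹`
because `W` is `C²`. This field is not compactly supported in `w`, so it is cut off beyond the
Grönwall bound `N` valid for `|t| < T`, and the `C¹` result for flows applies to it. -/
theorem IsFlow.contDiff_one_variation {V : ℝ → E → E →L[ℝ] E} (h : IsFlow W Φ)
    (hV : IsVariation W Φ V) (hW2 : ContDiff ℝ 2 W) (hs : HasCompactSupport W) (v : E) :
    ContDiff ℝ 1 fun x : ℝ × E => V x.1 x.2 v := by
  obtain ⟨K, hW⟩ := ContDiff.lipschitzWith_of_hasCompactSupport hs hW2 two_ne_zero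
  have hdW : ContDiff ℝ 1 (fderiv ℝ W) := hW2.fderiv_right (by norm_num)
  rw [contDiff_iff_contDiffAt]
  rintro ⟨t₀, p₀⟩
  set T := |t₀| + 1
  have hT : 0 < T := by positivity
  set N := Real.exp (K * T) * ‖v‖ + 1
  have hN : 0 < N := by positivity
  let χ : ContDiffBump (0 : E) := ⟨N, N + 1, hN, by linarith⟩
  let W' : E × E → E × E := fun x => χ x.2 • (W x.1, fderiv ℝ W x.1 x.2)
  have hW'1 : ContDiff ℝ 1 W' := by
    refine (χ.contDiff.comp contDiff_snd).smul (ContDiff.prodMk ?_ ?_)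
    · exact (hW2.of_le (by norm_num)).comp contDiff_fst
    · exact (hdW.comp contDiff_fst).clm_apply contDiff_snd
  have hW's : HasCompactSupport W' := by
    refine HasCompactSupport.intro (hs.isCompact.prod χ.hasCompactSupport.isCompact) ?_
    rintro ⟨p, w⟩ hpw
    rw [mem_prod, not_and_or] at hpw
    rcases hpw with hp | hw
    · have h1 : W p = 0 := image_eq_zero_of_notMem_tsupport hp
      have h2 : fderiv ℝ W p = 0 :=
        image_eq_zero_of_notMem_tsupport fun h' => hp (tsupport_fderiv_subset ℝ h')
      simp [W', h1, h2]
    · have : χ w = 0 := image_eq_zero_of_notMem_tsupport hw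
      simp [W', this]
  obtain ⟨K', hK'⟩ := ContDiff.lipschitzWith_of_hasCompactSupport hW's hW'1 one_ne_zero
  obtain ⟨Ψ, hΨ⟩ := exists_isFlow hK'
  have hΨ1 := hΨ.contDiff_one hW'1 hW's
  have key : ∀ p, ∀ t ∈ Ioo (-T) T, (Φ t p, V t p v) = Ψ t (p, v) := by
    intro p
    refine ODE_solution_unique_of_mem_Ioo (v := fun _ => W') (s := fun _ => univ) (K := K')
      (t₀ := 0) (fun t _ => hK'.lipschitzOnWith) ⟨by linarith, hT⟩ (fun t ht => ⟨?_, trivial⟩)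
      (fun t ht => ⟨hΨ.deriv t _, trivial⟩) (by simp [hV.zero, h.zero, hΨ.zero])
    have h1 : χ (V t p v) = 1 := by
      refine χ.one_of_mem_closedBall ?_
      rw [mem_closedBall_zero_iff]
      refine ((V t p).le_opNorm v).trans ?_
      have h2 := hV.norm_le hW t p
      have h3 : Real.exp (K * |t|) ≤ Real.exp (K * T) := by
        have := (abs_lt.2 ht).le
        gcongr
      calc ‖V t p‖ * ‖v‖ ≤ Real.exp (K * T) * ‖v‖ := by
            gcongr
            exact h2.trans h3
        _ ≤ N := by simp [N]
    have h4 : W' (Φ t p, V t p v) = (W (Φ t p), fderiv ℝ W (Φ t p) (V t p v)) := by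
      simp [W', h1]
    rw [h4]
    have h5 := (hV.deriv t p).clm_apply (hasDerivAt_const t v)
    simp only [map_zero, add_zero, ContinuousLinearMap.comp_apply] at h5
    exact (h.deriv t p).prodMk h5
  have h6 : ContDiff ℝ 1 fun x : ℝ × E => (Ψ x.1 (x.2, v)).2 :=
    contDiff_snd.comp (hΨ1.comp (contDiff_fst.prodMk (contDiff_snd.prodMk contDiff_const)))
  refine h6.contDiffAt.congr_of_eventuallyEq ?_
  have : ∀ᶠ x : ℝ × E in 𝓝 (t₀, p₀), x.1 ∈ Ioo (-T) T :=
    continuousAt_fst.eventually (Ioo_mem_nhds (by linarith [neg_abs_le t₀])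
      (by linarith [le_abs_self t₀]))
  filter_upwards [this] with x hx
  rw [← key x.2 x.1 hx]

/-- The flow of a compactly supported `C²` field is `C²` in time and initial condition, and its
derivative in the initial condition solves the equation of first variation. -/
theorem exists_isFlow_contDiff_two (hW2 : ContDiff ℝ 2 W) (hs : HasCompactSupport W) :
    ∃ (Φ : ℝ → E → E) (V : ℝ → E → E →L[ℝ] E), IsFlow W Φ ∧ IsVariation W Φ V ∧
      ContDiff ℝ 2 (fun x : ℝ × E => Φ x.1 x.2) ∧ ∀ t p, HasFDerivAt (Φ t) (V t p) p := by
  obtain ⟨K, hW⟩ := ContDiff.lipschitzWith_of_hasCompactSupport hs hW2 two_ne_zero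
  have hd := hW2.differentiable two_ne_zero
  have hu : UniformContinuous (fderiv ℝ W) :=
    (hs.fderiv ℝ).uniformContinuous_of_continuous (hW2.continuous_fderiv two_ne_zero)
  obtain ⟨Φ, h⟩ := exists_isFlow hW
  obtain ⟨V, hV⟩ := h.exists_isVariation hW (hW2.continuous_fderiv two_ne_zero)
  have hW1 : ContDiff ℝ 1 W := hW2.of_le (by norm_num)
  refine ⟨Φ, V, h, hV, ?_, h.hasFDerivAt hV hW hd hu⟩
  exact h.contDiff_succ hV hW hd hu (n := 1) (by exact_mod_cast hW1)
    (by exact_mod_cast h.contDiff_one hW1 hs)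
    (by exact_mod_cast h.contDiff_one_variation hV hW2 hs)

end SmoothFlow

/-! ### Cut-off flows carrying a parameter -/

theorem hasDerivAt_fst {E G : Type*} [NormedAddCommGroup E] [NormedSpace ℝ E]
    [NormedAddCommGroup G] [NormedSpace ℝ G] {u : ℝ → E × G} {u' : E × G} {t : ℝ}
    (h : HasDerivAt u u' t) : HasDerivAt (fun s => (u s).1) u'.1 t :=
  (ContinuousLinearMap.fst ℝ E G).hasFDerivAt.comp_hasDerivAt t h

theorem hasDerivAt_snd {E G : Type*} [NormedAddCommGroup E] [NormedSpace ℝ E]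
    [NormedAddCommGroup G] [NormedSpace ℝ G] {u : ℝ → E × G} {u' : E × G} {t : ℝ}
    (h : HasDerivAt u u' t) : HasDerivAt (fun s => (u s).2) u'.2 t :=
  (ContinuousLinearMap.snd ℝ E G).hasFDerivAt.comp_hasDerivAt t h

theorem exists_contDiff_hasCompactSupport_eqOn {E G : Type*} [NormedAddCommGroup E]
    [NormedSpace ℝ E] [FiniteDimensional ℝ E] [NormedAddCommGroup G] [NormedSpace ℝ G]
    {f : E → G} {O K : Set E} (hO : IsOpen O) (hf : ContDiffOn ℝ 2 f O) (hK : IsCompact K)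
    (hKO : K ⊆ O) :
    ∃ (χ : E → ℝ) (N : Set E), ContDiff ℝ 2 (fun p => χ p • f p) ∧
      HasCompactSupport (fun p => χ p • f p) ∧ IsOpen N ∧ K ⊆ N ∧ N ⊆ O ∧
      ∀ p ∈ N, χ p = 1 := by
  obtain ⟨K₁, hK₁, hKK₁, hK₁O⟩ := exists_compact_between hK hO hKO
  obtain ⟨K₂, hK₂, hKK₂, hK₂O⟩ := exists_compact_between hK₁ hO hK₁O
  obtain ⟨χ, h0, h1, -⟩ := exists_contMDiffMap_zero_one_of_isClosed (n := 2)
    (modelWithCornersSelf ℝ E) (s := (interior K₂)ᶜ) (t := K₁)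
    isOpen_interior.isClosed_compl hK₁.isClosed
    (disjoint_left.2 fun x hx hx' => hx (hKK₂ hx'))
  have hχ : ContDiff ℝ 2 χ := χ.contMDiff.contDiff
  have hsupp : tsupport χ ⊆ K₂ := by
    refine closure_minimal (fun x hx => ?_) hK₂.isClosed
    by_contra hx'
    exact hx (h0 fun h => hx' (interior_subset h))
  refine ⟨χ, interior K₁, ?_, ?_, isOpen_interior, hKK₁, interior_subset.trans hK₁O,
    fun p hp => h1 (interior_subset hp)⟩
  · rw [contDiff_iff_contDiffAt]
    intro p
    by_cases hp : p ∈ O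
    · exact hχ.contDiffAt.smul (hf.contDiffAt (hO.mem_nhds hp))
    · have hp' : p ∈ (tsupport χ)ᶜ := fun h => hp (hK₂O (hsupp h))
      refine (contDiffAt_const (c := (0 : G))).congr_of_eventuallyEq ?_
      filter_upwards [(isClosed_tsupport χ).isOpen_compl.mem_nhds hp'] with x hx
      simp [image_eq_zero_of_notMem_tsupport hx]
  · refine HasCompactSupport.intro hK₂ fun x hx => ?_
    simp [image_eq_zero_of_notMem_tsupport fun h => hx (hsupp h)]

/-- `Φ` is the flow of a compactly supported `C²` field `W` that agrees on the open set `N` with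
the field `X` extended by a constant parameter; `V` is the derivative of `Φ`. -/
structure LocalFlow (X : (ℝ × ℝ) × ℝ → ℝ × ℝ) (N : Set ((ℝ × ℝ) × ℝ))
    (W : (ℝ × ℝ) × ℝ → (ℝ × ℝ) × ℝ) (Φ : ℝ → (ℝ × ℝ) × ℝ → (ℝ × ℝ) × ℝ)
    (V : ℝ → (ℝ × ℝ) × ℝ → (ℝ × ℝ) × ℝ →L[ℝ] (ℝ × ℝ) × ℝ) : Prop where
  isOpen : IsOpen N
  eq : ∀ p ∈ N, W p = (X p, 0)
  snd : ∀ p, (W p).2 = 0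
  smooth_field : ContDiff ℝ 2 W
  compact : HasCompactSupport W
  flow : IsFlow W Φ
  variation : IsVariation W Φ V
  smooth : ContDiff ℝ 2 fun x : ℝ × ((ℝ × ℝ) × ℝ) => Φ x.1 x.2
  hasFDerivAt : ∀ t p, HasFDerivAt (Φ t) (V t p) p

/-- The parameter is a coordinate with zero velocity, so dependence on it is a case of dependence on
the initial condition. -/
theorem exists_localFlow {D : Set (ℝ × ℝ)} {I : Set ℝ} (hD : IsOpen D) (hI : IsOpen I)
    {X : (ℝ × ℝ) × ℝ → ℝ × ℝ} (hX : ContDiffOn ℝ 2 X (D ×ˢ I)) {K : Set ((ℝ × ℝ) × ℝ)}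
    (hK : IsCompact K) (hKO : K ⊆ D ×ˢ I) :
    ∃ N W Φ V, LocalFlow X N W Φ V ∧ K ⊆ N ∧ N ⊆ D ×ˢ I := by
  obtain ⟨χ, N, h1, h2, hN, hKN, hNO, hχ⟩ :=
    exists_contDiff_hasCompactSupport_eqOn (hD.prod hI) hX hK hKO
  have h3 : ContDiff ℝ 2 fun p => (χ p • X p, (0 : ℝ)) := h1.prodMk contDiff_const
  have h4 : HasCompactSupport fun p => (χ p • X p, (0 : ℝ)) :=
    h2.comp_left (g := fun z => (z, (0 : ℝ))) rfl
  obtain ⟨Φ, V, h5, h6, h7, h8⟩ := exists_isFlow_contDiff_two h3 h4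
  refine ⟨N, _, Φ, V, ⟨hN, fun p hp => ?_, fun _ => rfl, h3, h4, h5, h6, h7, h8⟩, hKN, hNO⟩
  simp [hχ p hp]

namespace LocalFlow

variable {X : (ℝ × ℝ) × ℝ → ℝ × ℝ} {N : Set ((ℝ × ℝ) × ℝ)}
    {W : (ℝ × ℝ) × ℝ → (ℝ × ℝ) × ℝ} {Φ : ℝ → (ℝ × ℝ) × ℝ → (ℝ × ℝ) × ℝ}
    {V : ℝ → (ℝ × ℝ) × ℝ → (ℝ × ℝ) × ℝ →L[ℝ] (ℝ × ℝ) × ℝ}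

theorem exists_lipschitz (h : LocalFlow X N W Φ V) : ∃ K, LipschitzWith K W :=
  ContDiff.lipschitzWith_of_hasCompactSupport h.compact h.smooth_field two_ne_zero

theorem param (h : LocalFlow X N W Φ V) (t : ℝ) (p : (ℝ × ℝ) × ℝ) : (Φ t p).2 = p.2 := by
  have hd : ∀ s, HasDerivAt (fun s => (Φ s p).2) 0 s := fun s => by
    have := hasDerivAt_snd (h.flow.deriv s p)
    rwa [h.snd] at this
  have := is_const_of_deriv_eq_zero (fun s => (hd s).differentiableAt)
    (fun s => (hd s).deriv) t 0
  simpa [h.flow.zero] using this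

theorem deriv_fst (h : LocalFlow X N W Φ V) {t : ℝ} {p : (ℝ × ℝ) × ℝ} (hp : Φ t p ∈ N) :
    HasDerivAt (fun s => (Φ s p).1) (X ((Φ t p).1, p.2)) t := by
  have := hasDerivAt_fst (h.flow.deriv t p)
  rw [h.eq _ hp] at this
  have e : ((Φ t p).1, p.2) = Φ t p := by rw [← h.param t p]
  rw [e]
  exact this

theorem continuous (h : LocalFlow X N W Φ V) :
    Continuous fun x : ℝ × ((ℝ × ℝ) × ℝ) => Φ x.1 x.2 := h.smooth.continuous

end LocalFlow

/-! ### Uniqueness, and identification of `flow` with the cut-off flow -/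

section Uniqueness

variable {F : ℝ × ℝ → ℝ × ℝ} {D : Set (ℝ × ℝ)}

theorem IsSolOn.continuousOn {J : Set ℝ} {u : ℝ → ℝ × ℝ} (hu : IsSolOn F D J u) :
    ContinuousOn u J := fun t ht => (hu t ht).2.continuousWithinAt

/-- `F` is only locally Lipschitz on `D`, but the two solution arcs form a compact subset of `D`, on
which it has a single Lipschitz constant. -/
theorem IsSolOn.eqOn (hD : IsOpen D) (hF : ContDiffOn ℝ 2 F D) {T : ℝ}
    {u v : ℝ → ℝ × ℝ} (hu : IsSolOn F D (Icc 0 T) u) (hv : IsSolOn F D (Icc 0 T) v)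
    (h0 : u 0 = v 0) : EqOn u v (Icc 0 T) := by
  set C := u '' Icc 0 T ∪ v '' Icc 0 T
  have hC : IsCompact C :=
    (isCompact_Icc.image_of_continuousOn hu.continuousOn).union
      (isCompact_Icc.image_of_continuousOn hv.continuousOn)
  have hCD : C ⊆ D := by
    rintro _ (⟨t, ht, rfl⟩ | ⟨t, ht, rfl⟩)
    exacts [(hu t ht).1, (hv t ht).1]
  obtain ⟨K, hK⟩ := LocallyLipschitzOn.exists_lipschitzOnWith_of_compact (f := F) hC (by
    intro x hx
    obtain ⟨K, t, ht, h⟩ := ((hF.contDiffAt (hD.mem_nhds (hCD hx))).of_le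
      (by norm_num : (1 : WithTop ℕ∞) ≤ 2)).exists_lipschitzOnWith
    exact ⟨K, t, mem_nhdsWithin_of_mem_nhds ht, h⟩)
  have hder : ∀ w : ℝ → ℝ × ℝ, IsSolOn F D (Icc 0 T) w → ∀ t ∈ Ico 0 T,
      HasDerivWithinAt w (F (w t)) (Ici t) t := fun w hw t ht =>
    (hw t (Ico_subset_Icc_self ht)).2.mono_of_mem_nhdsWithin
      (mem_of_superset (Icc_mem_nhdsGE ht.2) (Icc_subset_Icc_left ht.1))
  exact ODE_solution_unique_of_mem_Icc_right (v := fun _ => F) (s := fun _ => C) (fun _ _ => hK)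
    hu.continuousOn (hder u hu)
    (fun t ht => Or.inl (mem_image_of_mem u (Ico_subset_Icc_self ht)))
    hv.continuousOn (hder v hv)
    (fun t ht => Or.inr (mem_image_of_mem v (Ico_subset_Icc_self ht))) h0

/-- Uniqueness makes the choice in the definition of `flow` immaterial. -/
theorem flow_eq (hD : IsOpen D) (hF : ContDiffOn ℝ 2 F D) {T : ℝ} (hT : 0 ≤ T)
    {u : ℝ → ℝ × ℝ} (hu : IsSolOn F D (Icc 0 T) u) : flow F D T (u 0) = u T := by
  have hu' : InFlowDomain F D T (u 0) := ⟨u, rfl, by rwa [uIcc_of_le hT]⟩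
  rw [flow, dif_pos hu']
  have h0 : hu'.choose 0 = u 0 := hu'.choose_spec.1
  have h1 : IsSolOn F D (Icc 0 T) hu'.choose := uIcc_of_le hT ▸ hu'.choose_spec.2
  exact IsSolOn.eqOn hD hF h1 hu h0 ⟨hT, le_rfl⟩

theorem IsSolOn.mono {T T' : ℝ} {u : ℝ → ℝ × ℝ} (hu : IsSolOn F D (Icc 0 T) u) (h : T' ≤ T) :
    IsSolOn F D (Icc 0 T') u := fun t ht =>
  ⟨(hu t ⟨ht.1, ht.2.trans h⟩).1,
    (hu t ⟨ht.1, ht.2.trans h⟩).2.mono (Icc_subset_Icc_right h)⟩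

theorem returnTime_eq {x s : ℝ} (h : ReachesAt F D x s) : returnTime F D x = s := by
  obtain ⟨h0, h1, h2, h3, -⟩ := h
  refine IsLeast.csInf_eq ⟨⟨h0, h1, h3⟩, ?_⟩
  rintro t ⟨ht0, -, ht⟩
  by_contra! hlt
  exact (h2 t ⟨ht0, hlt⟩).ne ht

end Uniqueness

theorem LocalFlow.isSolOn {X : (ℝ × ℝ) × ℝ → ℝ × ℝ} {N : Set ((ℝ × ℝ) × ℝ)}
    {W : (ℝ × ℝ) × ℝ → (ℝ × ℝ) × ℝ} {Φ : ℝ → (ℝ × ℝ) × ℝ → (ℝ × ℝ) × ℝ}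
    {V : ℝ → (ℝ × ℝ) × ℝ → (ℝ × ℝ) × ℝ →L[ℝ] (ℝ × ℝ) × ℝ} (h : LocalFlow X N W Φ V)
    {D : Set (ℝ × ℝ)} {I : Set ℝ} (hN : N ⊆ D ×ˢ I) {F : ℝ × ℝ → ℝ × ℝ}
    (hF : ∀ z, F z = X (z, 0)) {T : ℝ} {z : ℝ × ℝ} (hT : ∀ t ∈ Icc 0 T, Φ t (z, 0) ∈ N) :
    IsSolOn F D (Icc 0 T) fun t => (Φ t (z, 0)).1 := fun t ht =>
  ⟨(hN (hT t ht)).1, by rw [hF]; exact (h.deriv_fst (hT t ht)).hasDerivWithinAt⟩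

theorem LocalFlow.flow_eq {X : (ℝ × ℝ) × ℝ → ℝ × ℝ} {N : Set ((ℝ × ℝ) × ℝ)}
    {W : (ℝ × ℝ) × ℝ → (ℝ × ℝ) × ℝ} {Φ : ℝ → (ℝ × ℝ) × ℝ → (ℝ × ℝ) × ℝ}
    {V : ℝ → (ℝ × ℝ) × ℝ → (ℝ × ℝ) × ℝ →L[ℝ] (ℝ × ℝ) × ℝ} (h : LocalFlow X N W Φ V)
    {D : Set (ℝ × ℝ)} {I : Set ℝ} (hD : IsOpen D) (hN : N ⊆ D ×ˢ I) {F : ℝ × ℝ → ℝ × ℝ}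
    (hFD : ContDiffOn ℝ 2 F D)
    (hF : ∀ z, F z = X (z, 0)) {T : ℝ} (hT0 : 0 ≤ T) {z : ℝ × ℝ}
    (hT : ∀ t ∈ Icc 0 T, Φ t (z, 0) ∈ N) :
    TwoFold.flow F D T z = (Φ T (z, 0)).1 := by
  have := TwoFold.flow_eq hD hFD hT0 (h.isSolOn hN hF hT)
  rwa [h.flow.zero] at this

/-- Flow with parameter in a neighbourhood of a given orbit. -/
theorem exists_localFlow_of_inFlowDomain {D : Set (ℝ × ℝ)} {I : Set ℝ} (hD : IsOpen D)
    (hI : IsOpen I) (hI0 : (0 : ℝ) ∈ I) {X : (ℝ × ℝ) × ℝ → ℝ × ℝ}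
    (hX : ContDiffOn ℝ 2 X (D ×ˢ I)) {F : ℝ × ℝ → ℝ × ℝ} (hF : ∀ z, F z = X (z, 0)) {s : ℝ}
    (hs : 0 ≤ s) {z : ℝ × ℝ} (h : InFlowDomain F D s z) :
    ∃ N W Φ V, LocalFlow X N W Φ V ∧ N ⊆ D ×ˢ I ∧ ∀ t ∈ Icc 0 s, Φ t (z, 0) ∈ N := by
  obtain ⟨u, rfl, hu⟩ := h
  rw [uIcc_of_le hs] at hu
  obtain ⟨N, W, Φ, V, hL, hKN, hN⟩ := exists_localFlow hD hI hX
    (K := (u '' Icc 0 s) ×ˢ {0})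
    ((isCompact_Icc.image_of_continuousOn hu.continuousOn).prod isCompact_singleton) (by
      rintro ⟨_, _⟩ ⟨⟨t, ht, rfl⟩, rfl⟩
      exact ⟨(hu t ht).1, hI0⟩)
  refine ⟨N, W, Φ, V, hL, hN, ?_⟩
  have hmem : ∀ t ∈ Icc 0 s, (u t, (0 : ℝ)) ∈ N := fun t ht =>
    hKN ⟨mem_image_of_mem u ht, rfl⟩
  obtain ⟨K, hK⟩ := hL.exists_lipschitz
  have := ODE_solution_unique (v := fun _ => W) (f := fun t => (u t, (0 : ℝ)))
    (g := fun t => Φ t (u 0, 0)) (a := 0) (b := s) (fun _ => hK)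
    (hu.continuousOn.prodMk continuousOn_const)
    (fun t ht => by
      have h1 := (hu t (Ico_subset_Icc_self ht)).2.mono_of_mem_nhdsWithin
        (mem_of_superset (Icc_mem_nhdsGE ht.2) (Icc_subset_Icc_left ht.1))
      rw [hL.eq _ (hmem t (Ico_subset_Icc_self ht)), ← hF]
      exact h1.prodMk (hasDerivWithinAt_const _ _ _))
    (fun t _ => (hL.flow.deriv t _).continuousAt.continuousWithinAt)
    (fun t _ => (hL.flow.deriv t _).hasDerivWithinAt) (hL.flow.zero _).symm
  intro t ht
  have e : (u t, (0 : ℝ)) = Φ t (u 0, 0) := this ht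
  exact e ▸ hmem t ht

/-! ### First return to zero under perturbation -/

theorem lt_of_hasDerivAt_neg {g g' : ℝ → ℝ} {a b : ℝ} (hab : a < b)
    (hg : ∀ t ∈ Icc a b, HasDerivAt g (g' t) t) (hneg : ∀ t ∈ Icc a b, g' t < 0) : g b < g a := by
  obtain ⟨c, hc, h⟩ := exists_hasDerivAt_eq_slope g g' hab
    (fun t ht => (hg t ht).continuousAt.continuousWithinAt)
    (fun t ht => hg t (Ioo_subset_Icc_self ht))
  have h1 := hneg c (Ioo_subset_Icc_self hc)
  rw [h, div_lt_iff₀ (by linarith)] at h1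
  linarith

theorem hasDerivAt_prodMk_right {Q G : Type*} [NormedAddCommGroup Q] [NormedSpace ℝ Q]
    [NormedAddCommGroup G] [NormedSpace ℝ G] {f : Q × ℝ → G} {q : Q} {t : ℝ}
    (hf : DifferentiableAt ℝ f (q, t)) :
    HasDerivAt (fun s => f (q, s)) (fderiv ℝ f (q, t) (0, 1)) t :=
  hf.hasFDerivAt.comp_hasDerivAt t ((hasDerivAt_const t q).prodMk (hasDerivAt_id t))

theorem isInvertible_of_apply_one_ne_zero {L : ℝ →L[ℝ] ℝ} (h : L 1 ≠ 0) : L.IsInvertible := by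
  refine ⟨ContinuousLinearEquiv.unitsEquivAut ℝ (Units.mk0 (L 1) h), ?_⟩
  ext
  simp

/-- First return to zero of the last variable of a function that leaves zero downwards and comes
back transversally. -/
theorem exists_hit_time {Q : Type*} [NormedAddCommGroup Q] [NormedSpace ℝ Q] [CompleteSpace Q]
    {f : Q × ℝ → ℝ} (hf : ContDiff ℝ 2 f) (hf0 : ∀ q, f (q, 0) = 0) {q₀ : Q} {s : ℝ} (hs : 0 < s)
    (hneg : ∀ t ∈ Ioo 0 s, f (q₀, t) < 0) (hz : f (q₀, s) = 0)
    (h0 : fderiv ℝ f (q₀, 0) (0, 1) < 0) (h1 : 0 < fderiv ℝ f (q₀, s) (0, 1)) :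
    ∃ T : Q → ℝ, ContDiffAt ℝ 2 T q₀ ∧ T q₀ = s ∧
      ∀ᶠ q in 𝓝 q₀, 0 < T q ∧ f (q, T q) = 0 ∧ ∀ t ∈ Ioo 0 (T q), f (q, t) < 0 := by
  have hfa : ContDiffAt ℝ 2 f (q₀, s) := hf.contDiffAt
  have hinv : (fderiv ℝ f (q₀, s) ∘L .inr ℝ Q ℝ).IsInvertible :=
    isInvertible_of_apply_one_ne_zero (by simpa using h1.ne')
  set T := hfa.implicitFunction two_ne_zero hinv with hT
  have hT0 : T q₀ = s := hfa.implicitFunction_apply_self two_ne_zero hinv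
  have hTC : ContDiffAt ℝ 2 T q₀ := hfa.contDiffAt_implicitFunction two_ne_zero hinv
  have hTz : ∀ᶠ q in 𝓝 q₀, f (q, T q) = 0 := by
    have := hfa.eventually_apply_implicitFunction two_ne_zero hinv
    simpa [hz] using this
  have hTt : Tendsto T (𝓝 q₀) (𝓝 s) := hT0 ▸ hTC.continuousAt
  have hdc : Continuous fun p : Q × ℝ => fderiv ℝ f p (0, 1) :=
    (hf.continuous_fderiv two_ne_zero).clm_apply continuous_const
  have hd : ∀ q t, HasDerivAt (fun s => f (q, s)) (fderiv ℝ f (q, t) (0, 1)) t := fun q t =>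
    hasDerivAt_prodMk_right (hf.differentiable two_ne_zero (q, t))
  have hTfst : ∀ τ, Tendsto (fun p : Q × ℝ => T p.1) (𝓝 (q₀, τ)) (𝓝 s) := fun τ =>
    hTt.comp continuousAt_fst
  have hsnd : ∀ τ : ℝ, Tendsto (fun p : Q × ℝ => p.2) (𝓝 (q₀, τ)) (𝓝 τ) := fun τ =>
    continuousAt_snd
  have hTz' : ∀ τ : ℝ, ∀ᶠ p : Q × ℝ in 𝓝 (q₀, τ), f (p.1, T p.1) = 0 := fun τ =>
    (show Tendsto (fun p : Q × ℝ => p.1) (𝓝 (q₀, τ)) (𝓝 q₀) from continuousAt_fst).eventually hTz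
  -- By compactness the claim is local in `t`. Near `0` the function decreases from zero; strictly
  -- between `0` and `s` it is negative by continuity; near `s` it increases up to its zero at `T
  -- q`; beyond `s` the condition `t < T q` fails, as `T q` tends to `s`. The margin `s + 1` ensures
  -- that the interval contains `[0, T q]`.
  have key : ∀ᶠ q in 𝓝 q₀, ∀ t ∈ Icc 0 (s + 1), 0 < t → t < T q → f (q, t) < 0 := by
    refine isCompact_Icc.eventually_forall_of_forall_eventually
      (P := fun q t => 0 < t → t < T q → f (q, t) < 0) fun τ hτ => ?_
    rcases hτ.1.eq_or_lt with rfl | hτ0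
    · obtain ⟨r, hr, hb⟩ := Metric.eventually_nhds_iff_ball.1
        (hdc.continuousAt.eventually_lt continuousAt_const h0)
      filter_upwards [ball_mem_nhds (q₀, (0 : ℝ)) hr] with p hp ht0 _
      have := lt_of_hasDerivAt_neg ht0 (fun t _ => hd p.1 t) (fun t ht => hb (p.1, t) (by
        rw [mem_ball, Prod.dist_eq, max_lt_iff] at hp ⊢
        refine ⟨hp.1, lt_of_le_of_lt ?_ hp.2⟩
        simp only [Real.dist_eq, sub_zero, abs_of_nonneg ht.1, abs_of_pos ht0]
        exact ht.2))
      simpa [hf0] using this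
    rcases lt_trichotomy τ s with hτs | rfl | hτs
    · have : f (q₀, τ) < 0 := hneg τ ⟨hτ0, hτs⟩
      filter_upwards [hf.continuous.continuousAt.eventually_lt continuousAt_const this] with p hp _ _
      exact hp
    · obtain ⟨r, hr, hb⟩ := Metric.eventually_nhds_iff_ball.1
        (continuousAt_const.eventually_lt hdc.continuousAt h1)
      filter_upwards [ball_mem_nhds (q₀, τ) hr, hTz' τ,
        (hTfst τ).eventually (ball_mem_nhds τ hr)] with p hp hp0 hpT _ htT
      have := lt_of_hasDerivAt_neg (g := fun t => -f (p.1, t)) htT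
        (fun t _ => (hd p.1 t).neg) (fun t ht => neg_neg_of_pos (hb (p.1, t) (by
          rw [mem_ball, Prod.dist_eq, max_lt_iff] at hp ⊢
          refine ⟨hp.1, ?_⟩
          rw [Real.dist_eq, abs_lt] at hpT
          have hp2 := hp.2
          simp only [Real.dist_eq, abs_lt] at hp2 ⊢
          constructor <;> linarith [ht.1, ht.2])))
      simp only [hp0, neg_zero] at this
      linarith
    · obtain ⟨m, hm1, hm2⟩ := exists_between hτs
      filter_upwards [(hTfst τ).eventually (gt_mem_nhds hm1),
        (hsnd τ).eventually (lt_mem_nhds hm2)] with p hp1 hp2 _ h3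
      linarith
  refine ⟨T, hTC, hT0, ?_⟩
  filter_upwards [key, hTz, hTt.eventually (lt_mem_nhds hs),
    hTt.eventually (gt_mem_nhds (lt_add_one s))] with q h1 h2 h3 h4
  exact ⟨h3, h2, fun t ht => h1 t ⟨ht.1.le, (ht.2.trans h4).le⟩ ht.1 ht.2⟩

/-! ### Persistence of simple zeros -/

/-- The derivative of a `C²` function is locally Lipschitz, so along the segment from `(x, 0)` to
`(x, ε)` the `ε`-derivative moves by at most `K ε`; the mean value inequality adds a second factor
`ε`. -/
theorem exists_eventually_abs_sub_le_sq {d : ℝ × ℝ → ℝ} {x₀ : ℝ} (hd : ContDiffAt ℝ 2 d (x₀, 0))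
    (h0 : ∀ᶠ x in 𝓝 x₀, d (x, 0) = 0) :
    ∃ K : ℝ≥0, ∃ r > 0, ∀ x, |x - x₀| < r → ∀ ε, 0 ≤ ε → ε < r →
      ContinuousAt d (x, ε) ∧ |d (x, ε) - ε * fderiv ℝ d (x, 0) (0, 1)| ≤ K * ε ^ 2 := by
  obtain ⟨K, U, hU, hK⟩ := (hd.fderiv_right (m := 1) (by norm_num)).exists_lipschitzOnWith
  obtain ⟨r, hr, hb⟩ := Metric.eventually_nhds_iff_ball.1
    ((hd.eventually (by simp)).and hU)
  obtain ⟨r', hr', hb'⟩ := Metric.eventually_nhds_iff_ball.1 h0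
  refine ⟨K, min r r', lt_min hr hr', fun x hx ε hε hεr => ?_⟩
  have hmem : ∀ t ∈ Icc 0 ε, (x, t) ∈ ball (x₀, (0 : ℝ)) r := fun t ht => by
    rw [mem_ball, Prod.dist_eq, max_lt_iff]
    simp only [Real.dist_eq, sub_zero, abs_of_nonneg ht.1]
    exact ⟨hx.trans_le (min_le_left _ _), lt_of_le_of_lt ht.2 (hεr.trans_le (min_le_left _ _))⟩
  have hx0 : d (x, 0) = 0 := hb' x (by simpa [Real.dist_eq] using hx.trans_le (min_le_right _ _))
  refine ⟨(hb _ (hmem ε ⟨hε, le_rfl⟩)).1.continuousAt, ?_⟩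
  have := norm_image_sub_le_of_norm_deriv_le_segment' (a := 0) (b := ε)
    (f := fun t => d (x, t) - t * fderiv ℝ d (x, 0) (0, 1))
    (f' := fun t => fderiv ℝ d (x, t) (0, 1) - fderiv ℝ d (x, 0) (0, 1)) (C := K * ε)
    (fun t ht => by
      have h1 := hasDerivAt_prodMk_right ((hb _ (hmem t ht)).1.differentiableAt two_ne_zero)
      have h2 := (hasDerivAt_id t).mul_const (fderiv ℝ d (x, 0) (0, 1))
      simpa using (h1.fun_sub h2).hasDerivWithinAt)
    (fun t ht => by
      have h1 := hK.norm_sub_le (hb _ (hmem t (Ico_subset_Icc_self ht))).2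
        (hb _ (hmem 0 ⟨le_rfl, hε⟩)).2
      rw [← sub_apply]
      refine (ContinuousLinearMap.le_opNorm _ _).trans ?_
      have h2 : ‖((0 : ℝ), (1 : ℝ))‖ = 1 := by simp [Prod.norm_def]
      have h3 : ‖(x, t) - (x, (0 : ℝ))‖ = t := by simp [Prod.norm_def, abs_of_nonneg ht.1, ht.1]
      rw [h2, mul_one]
      rw [h3] at h1
      exact h1.trans (by have := ht.2.le; gcongr)) ε ⟨hε, le_rfl⟩
  simp only [hx0, zero_mul, sub_zero, Real.norm_eq_abs] at this
  exact this.trans_eq (by ring)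

/-- A function vanishing for `ε = 0` whose derivative in `ε` there has a simple zero at `x₀` has
for each small `ε` a zero at distance `O(ε)` from `x₀`. -/
theorem exists_zero_of_simple_zero {d : ℝ × ℝ → ℝ} {x₀ : ℝ} (hd : ContDiffAt ℝ 2 d (x₀, 0))
    (h0 : ∀ᶠ x in 𝓝 x₀, d (x, 0) = 0) (he0 : fderiv ℝ d (x₀, 0) (0, 1) = 0) {a : ℝ}
    (he : HasDerivAt (fun x => fderiv ℝ d (x, 0) (0, 1)) a x₀) (ha : a ≠ 0) :
    ∃ C > 0, ∃ ε₁ > 0, ∀ ε ∈ Ioo 0 ε₁, ∃ x, |x - x₀| ≤ C * ε ∧ d (x, ε) = 0 := by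
  obtain ⟨K, r, hr, hK⟩ := exists_eventually_abs_sub_le_sq hd h0
  have ha' : 0 < |a| := abs_pos.2 ha
  have hlo := (hasDerivAt_iff_isLittleO.1 he).def (half_pos ha')
  obtain ⟨r', hr', hb⟩ := Metric.eventually_nhds_iff_ball.1 hlo
  -- At distance `C ε` from `x₀` the linear term has size `2 (K + 1) ε²`. Half of it absorbs the
  -- error in linearising `e`, and the rest exceeds the Taylor remainder `K ε²`.
  set C : ℝ := 2 * (K + 1) / |a| with hC
  have hC0 : 0 < C := by positivity
  have hCa : |a| * C = 2 * (K + 1) := by rw [hC]; field_simp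
  refine ⟨C, hC0, min (min r (r / C)) (r' / C), by positivity, fun ε hε => ?_⟩
  have hε0 := hε.1
  have hε1 : ε < r := hε.2.trans_le ((min_le_left _ _).trans (min_le_left _ _))
  have hε2 : C * ε < r := by
    have := hε.2.trans_le ((min_le_left _ _).trans (min_le_right _ _))
    rwa [lt_div_iff₀' hC0] at this
  have hε3 : C * ε < r' := by
    have := hε.2.trans_le (min_le_right _ _)
    rwa [lt_div_iff₀' hC0] at this
  have hCε : 0 < C * ε := by positivity
  -- Multiplying by `a` makes the sign of `a * d` at `x₀ + h` that of `h`, whatever the sign of `a`.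
  have hlin : ∀ h, |h| = C * ε →
      |a * d (x₀ + h, ε) - a ^ 2 * ε * h| < a ^ 2 * ε * (C * ε) := by
    intro h hh
    have h1 := (hK (x₀ + h) (by simpa [hh] using hε2) ε hε0.le hε1).2
    have h2 := hb (x₀ + h) (by simpa [Real.dist_eq, hh] using hε3)
    simp only [he0, add_sub_cancel_left, sub_zero, Real.norm_eq_abs, smul_eq_mul, hh] at h2
    set e := fderiv ℝ d (x₀ + h, 0) (0, 1)
    have h3 : a * d (x₀ + h, ε) - a ^ 2 * ε * h
        = a * (d (x₀ + h, ε) - ε * e) + a * ε * (e - h * a) := by ring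
    have h4 : a ^ 2 = |a| * |a| := by rw [abs_mul_abs_self]; ring
    rw [h3, h4]
    refine lt_of_le_of_lt (abs_add_le _ _) ?_
    rw [abs_mul, abs_mul, abs_mul, abs_of_pos hε0]
    calc |a| * |d (x₀ + h, ε) - ε * e| + |a| * ε * |e - h * a|
        ≤ |a| * (K * ε ^ 2) + |a| * ε * (|a| / 2 * (C * ε)) := by gcongr
      _ = |a| * ε ^ 2 * (K + (|a| * C) / 2) := by ring
      _ < |a| * ε ^ 2 * (|a| * C) := by
          have : (K : ℝ) + (|a| * C) / 2 < |a| * C := by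
            rw [hCa]
            have := K.2
            linarith
          gcongr
      _ = |a| * |a| * ε * (C * ε) := by ring
  have hp := abs_lt.1 (hlin (C * ε) (abs_of_pos hCε))
  have hm := abs_lt.1 (hlin (-(C * ε)) (by rw [abs_neg, abs_of_pos hCε]))
  have hcont : ContinuousOn (fun x => a * d (x, ε)) (Icc (x₀ + -(C * ε)) (x₀ + C * ε)) := by
    intro x hx
    have hx' : |x - x₀| < r := lt_of_le_of_lt (abs_le.2 ⟨by linarith [hx.1], by linarith [hx.2]⟩) hε2
    have h1 := (hK x hx' ε hε0.le hε1).1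
    have h2 : ContinuousAt (fun x : ℝ => d (x, ε)) x :=
      ContinuousAt.comp (f := fun x : ℝ => (x, ε)) h1 (by fun_prop)
    exact (h2.const_mul a).continuousWithinAt
  obtain ⟨x, hx, hx0⟩ := intermediate_value_Icc (by linarith) hcont
    (show (0 : ℝ) ∈ Icc _ _ from ⟨by nlinarith [hm.2], by nlinarith [hp.1]⟩)
  refine ⟨x, abs_le.2 ⟨by linarith [hx.1], by linarith [hx.2]⟩, ?_⟩
  exact (mul_eq_zero.1 hx0).resolve_left ha

/-! ### Variation of constants -/

/-- For the solution of the adjoint equation `Z' = -Z DW` the product `Z V` has zero derivative. It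
is thus the identity, and in finite dimension a left inverse is a right inverse. -/
theorem IsVariation.exists_inverse {E : Type*} [NormedAddCommGroup E] [NormedSpace ℝ E]
    [FiniteDimensional ℝ E] {W : E → E} {Φ : ℝ → E → E} {K : ℝ≥0} {V : ℝ → E → E →L[ℝ] E}
    (hV : IsVariation W Φ V) (h : IsFlow W Φ) (hW : LipschitzWith K W)
    (hc : Continuous (fderiv ℝ W)) (p : E) :
    ∃ Z : ℝ → E →L[ℝ] E, Z 0 = ContinuousLinearMap.id ℝ E ∧
      (∀ t, HasDerivAt Z (-(Z t).comp (fderiv ℝ W (Φ t p))) t) ∧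
      (∀ t v, Z t (V t p v) = v) ∧ ∀ t v, V t p (Z t v) = v := by
  have hΦ : Continuous fun t => Φ t p :=
    continuous_iff_continuousAt.2 fun t => (h.deriv t p).continuousAt
  obtain ⟨Z, h0, h1⟩ := exists_global_solution
    (f := fun t (X : E →L[ℝ] E) => -X.comp (fderiv ℝ W (Φ t p))) (K := K)
    (fun t => by
      refine LipschitzWith.of_dist_le_mul fun X Y => ?_
      rw [dist_neg_neg, dist_eq_norm, dist_eq_norm, ← ContinuousLinearMap.sub_comp, mul_comm]
      refine (ContinuousLinearMap.opNorm_comp_le _ _).trans ?_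
      gcongr
      exact norm_fderiv_le_of_lipschitz ℝ hW)
    (fun X => (continuous_const.clm_comp (hc.comp hΦ)).neg) (ContinuousLinearMap.id ℝ E)
  have hd : ∀ t, HasDerivAt (fun t => (Z t).comp (V t p)) 0 t := fun t => by
    have := (h1 t).clm_comp (hV.deriv t p)
    convert this using 1
    ext v
    simp
  have hleft : ∀ t, (Z t).comp (V t p) = ContinuousLinearMap.id ℝ E := fun t => by
    have := is_const_of_deriv_eq_zero (fun s => (hd s).differentiableAt) (fun s => (hd s).deriv) t 0
    simpa [h0, hV.zero] using this
  have hright : ∀ t, ((V t p : E →L[ℝ] E) : E →ₗ[ℝ] E) * (Z t : E →ₗ[ℝ] E) = 1 := fun t => by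
    rw [mul_eq_one_comm]
    ext v
    simpa using DFunLike.congr_fun (hleft t) v
  exact ⟨Z, h0, h1, fun t v => DFunLike.congr_fun (hleft t) v,
    fun t v => DFunLike.congr_fun (hright t) v⟩

namespace LocalFlow

variable {X : (ℝ × ℝ) × ℝ → ℝ × ℝ} {N : Set ((ℝ × ℝ) × ℝ)}
    {W : (ℝ × ℝ) × ℝ → (ℝ × ℝ) × ℝ} {Φ : ℝ → (ℝ × ℝ) × ℝ → (ℝ × ℝ) × ℝ}
    {V : ℝ → (ℝ × ℝ) × ℝ → (ℝ × ℝ) × ℝ →L[ℝ] (ℝ × ℝ) × ℝ}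

theorem variation_snd (h : LocalFlow X N W Φ V) (t : ℝ) (p v : (ℝ × ℝ) × ℝ) :
    (V t p v).2 = v.2 := by
  have h1 : HasFDerivAt (fun q => (Φ t q).2) ((ContinuousLinearMap.snd ℝ (ℝ × ℝ) ℝ).comp (V t p)) p :=
    (ContinuousLinearMap.snd ℝ (ℝ × ℝ) ℝ).hasFDerivAt.comp p (h.hasFDerivAt t p)
  have h2 : (fun q => (Φ t q).2) = fun q => q.2 := funext fun q => h.param t q
  rw [h2] at h1
  have := h1.unique (ContinuousLinearMap.snd ℝ (ℝ × ℝ) ℝ).hasFDerivAt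
  exact DFunLike.congr_fun this v

theorem fderiv_field (h : LocalFlow X N W Φ V) {p : (ℝ × ℝ) × ℝ} (hp : p ∈ N)
    (v : (ℝ × ℝ) × ℝ) : fderiv ℝ W p v = (fderiv ℝ X p v, 0) := by
  have hW := (h.smooth_field.differentiable two_ne_zero p).hasFDerivAt
  have h1 : HasFDerivAt (fun q => (W q).1)
      ((ContinuousLinearMap.fst ℝ (ℝ × ℝ) ℝ).comp (fderiv ℝ W p)) p :=
    (ContinuousLinearMap.fst ℝ (ℝ × ℝ) ℝ).hasFDerivAt.comp p hW
  have h2 : HasFDerivAt (fun q => (W q).2)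
      ((ContinuousLinearMap.snd ℝ (ℝ × ℝ) ℝ).comp (fderiv ℝ W p)) p :=
    (ContinuousLinearMap.snd ℝ (ℝ × ℝ) ℝ).hasFDerivAt.comp p hW
  have h3 : HasFDerivAt X ((ContinuousLinearMap.fst ℝ (ℝ × ℝ) ℝ).comp (fderiv ℝ W p)) p := by
    refine h1.congr_of_eventuallyEq ?_
    filter_upwards [h.isOpen.mem_nhds hp] with q hq
    rw [h.eq q hq]
  have h4 : (fun q => (W q).2) = fun _ => (0 : ℝ) := funext h.snd
  rw [h4] at h2
  have h5 := h2.unique (hasFDerivAt_const (0 : ℝ) p)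
  rw [h3.fderiv]
  exact Prod.ext rfl (DFunLike.congr_fun h5 v)

theorem eventually_forall_mem (h : LocalFlow X N W Φ V) {T : ℝ} {p : (ℝ × ℝ) × ℝ}
    (hp : ∀ t ∈ Icc 0 T, Φ t p ∈ N) : ∀ᶠ q in 𝓝 p, ∀ t ∈ Icc 0 T, Φ t q ∈ N := by
  refine isCompact_Icc.eventually_forall_of_forall_eventually (P := fun q t => Φ t q ∈ N)
    fun t ht => ?_
  have : Continuous fun x : ((ℝ × ℝ) × ℝ) × ℝ => Φ x.2 x.1 :=
    h.continuous.comp (continuous_snd.prodMk continuous_fst)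
  exact this.continuousAt.eventually (h.isOpen.mem_nhds (hp t ht))

theorem uncurry_hasFDerivAt (h : LocalFlow X N W Φ V) (t : ℝ) (p : (ℝ × ℝ) × ℝ) :
    HasFDerivAt (fun x : ℝ × ((ℝ × ℝ) × ℝ) => Φ x.1 x.2)
      ((ContinuousLinearMap.toSpanSingleton ℝ (W (Φ t p))).coprod (V t p)) (t, p) := by
  set g : ℝ × ((ℝ × ℝ) × ℝ) → (ℝ × ℝ) × ℝ := fun x => Φ x.1 x.2
  have hd : HasFDerivAt g (fderiv ℝ g (t, p)) (t, p) :=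
    (h.smooth.differentiable two_ne_zero (t, p)).hasFDerivAt
  have h1 : HasDerivAt (fun s => Φ s p) (fderiv ℝ g (t, p) (1, 0)) t :=
    HasFDerivAt.comp_hasDerivAt (f := fun s => (s, p)) t hd
      ((hasDerivAt_id t).prodMk (hasDerivAt_const t p))
  have h2 : HasFDerivAt (Φ t) ((fderiv ℝ g (t, p)).comp
      (ContinuousLinearMap.inr ℝ ℝ ((ℝ × ℝ) × ℝ))) p :=
    HasFDerivAt.comp (f := fun q => (t, q)) p hd
      ((hasFDerivAt_const t p).prodMk (hasFDerivAt_id p))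
  have e : (ContinuousLinearMap.toSpanSingleton ℝ (W (Φ t p))).coprod (V t p)
      = fderiv ℝ g (t, p) := by
    rw [h1.unique (h.flow.deriv t p) |>.symm, (h.hasFDerivAt t p).unique h2]
    refine ContinuousLinearMap.ext fun x => ?_
    have e : x = x.1 • ((1 : ℝ), (0 : (ℝ × ℝ) × ℝ)) + (0, x.2) := by
      ext <;> simp
    conv_rhs => rw [e, map_add, map_smul]
    simp
  rw [e]
  exact hd

section Fundamental

variable {D : Set (ℝ × ℝ)} {I : Set ℝ} {F : ℝ × ℝ → ℝ × ℝ}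

/-- Initial points near `z` also have orbits inside `N`, so `flow` and `Φ` agree in a neighbourhood
and may be differentiated alike: `Y` is the spatial block of `V`. -/
theorem fundamental_eq (h : LocalFlow X N W Φ V) (hD : IsOpen D) (hN : N ⊆ D ×ˢ I)
    (hFD : ContDiffOn ℝ 2 F D) (hF : ∀ z, F z = X (z, 0)) {T : ℝ} (hT0 : 0 ≤ T) {z : ℝ × ℝ}
    (hT : ∀ t ∈ Icc 0 T, Φ t (z, 0) ∈ N) :
    fundamental F D T z = ((ContinuousLinearMap.fst ℝ (ℝ × ℝ) ℝ).comp (V T (z, 0))).comp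
      (ContinuousLinearMap.inl ℝ (ℝ × ℝ) ℝ) := by
  have hev : (fun w => TwoFold.flow F D T w) =ᶠ[𝓝 z] fun w => (Φ T (w, 0)).1 := by
    have hc : ContinuousAt (fun w : ℝ × ℝ => (w, (0 : ℝ))) z := by fun_prop
    filter_upwards [hc.eventually (h.eventually_forall_mem hT)] with w hw
    exact h.flow_eq hD hN hFD hF hT0 hw
  rw [fundamental, hev.fderiv_eq]
  have h1 : HasFDerivAt (fun w : ℝ × ℝ => (w, (0 : ℝ))) (ContinuousLinearMap.inl ℝ (ℝ × ℝ) ℝ) z :=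
    (ContinuousLinearMap.inl ℝ (ℝ × ℝ) ℝ).hasFDerivAt
  exact ((ContinuousLinearMap.fst ℝ (ℝ × ℝ) ℝ).hasFDerivAt.comp z
    ((h.hasFDerivAt T (z, 0)).comp z h1)).fderiv

/-- Variation of constants: the derivative of the flow in the parameter. -/
theorem variation_of_constants (h : LocalFlow X N W Φ V) (hD : IsOpen D) (hN : N ⊆ D ×ˢ I)
    (hFD : ContDiffOn ℝ 2 F D) (hF : ∀ z, F z = X (z, 0)) {T : ℝ} (hT0 : 0 ≤ T) {z : ℝ × ℝ}
    (hT : ∀ t ∈ Icc 0 T, Φ t (z, 0) ∈ N) :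
    IntervalIntegrable (fun t => (fundamental F D t z).inverse
      (fderiv ℝ X (TwoFold.flow F D t z, 0) (0, 1))) MeasureTheory.volume 0 T ∧
    (V T (z, 0) (0, 1)).1 = fundamental F D T z (∫ t in (0 : ℝ)..T,
      (fundamental F D t z).inverse (fderiv ℝ X (TwoFold.flow F D t z, 0) (0, 1))) := by
  obtain ⟨K, hK⟩ := h.exists_lipschitz
  have hc : Continuous (fderiv ℝ W) := h.smooth_field.continuous_fderiv two_ne_zero
  obtain ⟨Z, hZ0, hZd, hZV, hVZ⟩ := h.variation.exists_inverse h.flow hK hc (z, 0)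
  -- Both `V` and `Z` preserve the parameter coordinate, so they are block triangular and the
  -- spatial block of `Z` inverts that of `V`.
  have hZsnd : ∀ t v, (Z t v).2 = v.2 := fun t v => by
    rw [← h.variation_snd t (z, 0) (Z t v), hVZ]
  have hinl : ∀ w : (ℝ × ℝ) × ℝ, w.2 = 0 → (w.1, (0 : ℝ)) = w := fun w hw => Prod.ext rfl hw.symm
  have hsub : ∀ t ∈ Icc 0 T, ∀ s ∈ Icc 0 t, Φ s (z, 0) ∈ N := fun t ht s hs =>
    hT s ⟨hs.1, hs.2.trans ht.2⟩
  have hY : ∀ t ∈ Icc 0 T, ∀ v, fundamental F D t z v = (V t (z, 0) (v, 0)).1 := fun t ht v => by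
    rw [h.fundamental_eq hD hN hFD hF ht.1 (hsub t ht)]
    simp
  have hinv : ∀ t ∈ Icc 0 T, ∀ v, (fundamental F D t z).inverse v = (Z t (v, 0)).1 :=
    fun t ht v => by
    have : (fundamental F D t z).inverse = ((ContinuousLinearMap.fst ℝ (ℝ × ℝ) ℝ).comp (Z t)).comp
        (ContinuousLinearMap.inl ℝ (ℝ × ℝ) ℝ) := by
      refine ContinuousLinearMap.inverse_eq ?_ ?_
      · refine ContinuousLinearMap.ext fun v => ?_
        simp [hY t ht, hinl (Z t (v, 0)) (hZsnd t _), hVZ]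
      · refine ContinuousLinearMap.ext fun v => ?_
        simp [hY t ht, hinl (V t (z, 0) (v, 0)) (h.variation_snd t _ _), hZV]
    rw [this]
    simp
  have hint : ∀ t ∈ Icc 0 T, (fundamental F D t z).inverse
      (fderiv ℝ X (TwoFold.flow F D t z, 0) (0, 1)) =
      (Z t (fderiv ℝ W (Φ t (z, 0)) (0, 1))).1 := fun t ht => by
    have e : (TwoFold.flow F D t z, (0 : ℝ)) = Φ t (z, 0) := by
      rw [h.flow_eq hD hN hFD hF ht.1 (hsub t ht)]
      exact hinl _ (h.param t _)
    rw [hinv t ht, h.fderiv_field (hT t ht), e]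
  have hΦ : Continuous fun t => Φ t (z, 0) :=
    continuous_iff_continuousAt.2 fun t => (h.flow.deriv t _).continuousAt
  have hZc : Continuous Z := continuous_iff_continuousAt.2 fun t => (hZd t).continuousAt
  have hcont : Continuous fun t => (Z t (fderiv ℝ W (Φ t (z, 0)) (0, 1))).1 :=
    (hZc.clm_apply ((hc.comp hΦ).clm_apply continuous_const)).fst
  refine ⟨(hcont.continuousOn.congr fun t ht => ?_).intervalIntegrable, ?_⟩
  · rw [uIcc_of_le hT0] at ht
    exact hint t ht
  -- The adjoint equation exhibits an explicit primitive of the integrand.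
  have hζ : ∀ t, HasDerivAt (fun t => -(Z t (0, 1)).1)
      (Z t (fderiv ℝ W (Φ t (z, 0)) (0, 1))).1 t := fun t => by
    have := hasDerivAt_fst ((hZd t).clm_apply (hasDerivAt_const t ((0 : ℝ × ℝ), (1 : ℝ))))
    simpa using this.fun_neg
  have hI : (∫ t in (0 : ℝ)..T, (fundamental F D t z).inverse
      (fderiv ℝ X (TwoFold.flow F D t z, 0) (0, 1))) = -(Z T (0, 1)).1 := by
    rw [intervalIntegral.integral_congr (g := fun t => (Z t (fderiv ℝ W (Φ t (z, 0)) (0, 1))).1)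
      (fun t ht => hint t (by rwa [uIcc_of_le hT0] at ht)),
      intervalIntegral.integral_eq_sub_of_hasDerivAt (fun t _ => hζ t)
        (hcont.intervalIntegrable _ _), hZ0]
    simp
  rw [hI, map_neg, hY T ⟨hT0, le_rfl⟩]
  -- The first component of `V Z (0, 1) = (0, 1)` now expresses the parameter column of `V` through
  -- `Y` and the integral.
  have e : Z T (0, 1) = ((Z T (0, 1)).1, (0 : ℝ)) + (0, 1) := by
    refine Prod.ext (by simp) ?_
    simp [hZsnd]
  have h1 := hVZ T (0, 1)
  rw [e, map_add] at h1
  have h2 := congrArg Prod.fst h1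
  simp only [Prod.fst_add] at h2
  exact (neg_eq_of_add_eq_zero_right h2).symm

end Fundamental

end LocalFlow

/-! ### The half-return map -/

theorem hasDerivAt_nonpos_of_eventually_le_right {g : ℝ → ℝ} {c a : ℝ} (h : HasDerivAt g c a)
    (hg : ∀ᶠ t in 𝓝[>] a, g t ≤ g a) : c ≤ 0 := by
  have h1 := (hasDerivAt_iff_tendsto_slope.1 h).mono_left
    (nhdsWithin_mono a (show Ioi a ⊆ {a}ᶜ from fun t ht => ne_of_gt ht))
  refine le_of_tendsto h1 ?_
  filter_upwards [hg, self_mem_nhdsWithin] with t ht hta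
  rw [slope_def_field]
  exact div_nonpos_of_nonpos_of_nonneg (by linarith) (by have : a < t := hta; linarith)

theorem hasDerivAt_nonneg_of_eventually_le_left {g : ℝ → ℝ} {c a : ℝ} (h : HasDerivAt g c a)
    (hg : ∀ᶠ t in 𝓝[<] a, g t ≤ g a) : 0 ≤ c := by
  have h1 := (hasDerivAt_iff_tendsto_slope.1 h).mono_left
    (nhdsWithin_mono a (show Iio a ⊆ {a}ᶜ from fun t ht => ne_of_lt ht))
  refine ge_of_tendsto h1 ?_
  filter_upwards [hg, self_mem_nhdsWithin] with t ht hta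
  rw [slope_def_field]
  exact div_nonneg_of_nonpos (by linarith) (by have : t < a := hta; linarith)

/-- The solution of `dw/dt = X(w, q.2)` from `(q.1, 0)` crosses `y < 0` in time `T` and comes back to
the switching line at `(P, 0)`, transversally at both ends. -/
def HalfOrbit (X : (ℝ × ℝ) × ℝ → ℝ × ℝ) (D : Set (ℝ × ℝ)) (q : ℝ × ℝ) (T P : ℝ) : Prop :=
  0 < T ∧ (X ((q.1, 0), q.2)).2 < 0 ∧ 0 < (X ((P, 0), q.2)).2 ∧
    ∃ u : ℝ → ℝ × ℝ, u 0 = (q.1, 0) ∧ u T = (P, 0) ∧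
      (∀ t ∈ Icc 0 T, u t ∈ D ∧ HasDerivAt u (X (u t, q.2)) t) ∧ ∀ t ∈ Ioo 0 T, (u t).2 < 0

theorem HalfOrbit.isSolOn {X : (ℝ × ℝ) × ℝ → ℝ × ℝ} {D : Set (ℝ × ℝ)} {F : ℝ × ℝ → ℝ × ℝ}
    (hF : ∀ z, F z = X (z, 0)) {T : ℝ} {u : ℝ → ℝ × ℝ}
    (hu : ∀ t ∈ Icc 0 T, u t ∈ D ∧ HasDerivAt u (X (u t, 0)) t) : IsSolOn F D (Icc 0 T) u :=
  fun t ht => ⟨(hu t ht).1, by rw [hF]; exact (hu t ht).2.hasDerivWithinAt⟩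

theorem HalfOrbit.flow_mem {X : (ℝ × ℝ) × ℝ → ℝ × ℝ} {D : Set (ℝ × ℝ)} (hD : IsOpen D)
    {F : ℝ × ℝ → ℝ × ℝ} (hFD : ContDiffOn ℝ 2 F D) (hF : ∀ z, F z = X (z, 0)) {x T P : ℝ}
    (h : HalfOrbit X D (x, 0) T P) :
    flow F D T (x, 0) = (P, 0) ∧
      ∀ t ∈ Icc 0 T, flow F D t (x, 0) ∈ D ∧ (flow F D t (x, 0)).2 ≤ 0 := by
  obtain ⟨h0, -, -, u, hu0, huT, hu, hneg⟩ := h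
  have hsol := HalfOrbit.isSolOn hF hu
  have key : ∀ t ∈ Icc 0 T, flow F D t (x, 0) = u t := fun t ht => by
    rw [← hu0]
    exact flow_eq hD hFD ht.1 (hsol.mono ht.2)
  refine ⟨by rw [key T ⟨h0.le, le_rfl⟩, huT], fun t ht => ?_⟩
  rw [key t ht]
  refine ⟨(hu t ht).1, ?_⟩
  rcases ht.1.eq_or_lt with rfl | h1
  · simp [hu0]
  rcases ht.2.eq_or_lt with rfl | h2
  · simp [huT]
  exact (hneg t ⟨h1, h2⟩).le

theorem HalfOrbit.reachesAt {X : (ℝ × ℝ) × ℝ → ℝ × ℝ} {D : Set (ℝ × ℝ)} (hD : IsOpen D)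
    {F : ℝ × ℝ → ℝ × ℝ} (hFD : ContDiffOn ℝ 2 F D) (hF : ∀ z, F z = X (z, 0)) {x T P : ℝ}
    (h : HalfOrbit X D (x, 0) T P) : ReachesAt F D x T := by
  have hfl := (h.flow_mem hD hFD hF).1
  obtain ⟨h0, -, hX, u, hu0, huT, hu, hneg⟩ := h
  have hsol := HalfOrbit.isSolOn hF hu
  refine ⟨h0, ⟨u, hu0, by rwa [uIcc_of_le h0.le]⟩, fun t ht => ?_, by rw [hfl], ?_⟩
  · rw [← hu0, flow_eq hD hFD ht.1.le (hsol.mono ht.2.le)]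
    exact hneg t ht
  · rw [hfl, hF]
    exact hX.ne'

/-- Existence, smoothness and first-order expansion of the half-return map near a transversal
half-orbit. -/
theorem exists_halfReturn {D : Set (ℝ × ℝ)} (hD : IsOpen D) {I : Set ℝ} (hI : IsOpen I)
    (hI0 : (0 : ℝ) ∈ I) {X : (ℝ × ℝ) × ℝ → ℝ × ℝ} (hX : ContDiffOn ℝ 2 X (D ×ˢ I))
    {F : ℝ × ℝ → ℝ × ℝ} (hFD : ContDiffOn ℝ 2 F D) (hF : ∀ z, F z = X (z, 0)) {x₀ s : ℝ}
    (hr : ReachesAt F D x₀ s) (hne : (F (x₀, 0)).2 ≠ 0) :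
    ∃ T P : ℝ × ℝ → ℝ, ContDiffAt ℝ 2 P (x₀, 0) ∧
      (∀ᶠ q in 𝓝 (x₀, (0 : ℝ)), HalfOrbit X D q (T q) (P q)) ∧
      ∀ᶠ x in 𝓝 x₀, IntervalIntegrable (fun t => (fundamental F D t (x, 0)).inverse
          (fderiv ℝ X (flow F D t (x, 0), 0) (0, 1))) MeasureTheory.volume 0 (T (x, 0)) ∧
        ∃ p' : ℝ, HasDerivAt (fun ε => P (x, ε)) p' 0 ∧
          p' * (F (P (x, 0), 0)).2 = -wedge (F (P (x, 0), 0))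
            (fundamental F D (T (x, 0)) (x, 0) (∫ t in (0 : ℝ)..T (x, 0),
              (fundamental F D t (x, 0)).inverse
                (fderiv ℝ X (flow F D t (x, 0), 0) (0, 1)))) := by
  obtain ⟨hs, hdom, hfneg, hfz, hft⟩ := hr
  obtain ⟨N, W, Φ, V, h, hN, hΦN⟩ :=
    exists_localFlow_of_inFlowDomain hD hI hI0 hX hF hs.le hdom
  have hflow : ∀ t ∈ Icc 0 s, flow F D t (x₀, 0) = (Φ t ((x₀, 0), 0)).1 := fun t ht =>
    h.flow_eq hD hN hFD hF ht.1 fun r hr => hΦN r ⟨hr.1, hr.2.trans ht.2⟩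
  set ι : ℝ × ℝ → (ℝ × ℝ) × ℝ := fun q => ((q.1, 0), q.2) with hι
  have hιC : ContDiff ℝ 2 ι := (contDiff_fst.prodMk contDiff_const).prodMk contDiff_snd
  set f : (ℝ × ℝ) × ℝ → ℝ := fun a => (Φ a.2 (ι a.1)).1.2 with hf
  have hfC : ContDiff ℝ 2 f :=
    contDiff_snd.comp (contDiff_fst.comp
      (h.smooth.comp (contDiff_snd.prodMk (hιC.comp contDiff_fst))))
  have hfd : ∀ q t, HasDerivAt (fun r => f (q, r)) (W (Φ t (ι q))).1.2 t := fun q t =>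
    hasDerivAt_snd (hasDerivAt_fst (h.flow.deriv t (ι q)))
  have hfd' : ∀ q t, fderiv ℝ f (q, t) (0, 1) = (W (Φ t (ι q))).1.2 := fun q t =>
    (hasDerivAt_prodMk_right (hfC.differentiable two_ne_zero (q, t))).unique (hfd q t)
  have hf0 : ∀ q, f (q, 0) = 0 := fun q => by simp [hf, hι, h.flow.zero]
  have hι0 : ∀ x, ι (x, 0) = ((x, 0), 0) := fun _ => rfl
  have hWF : ∀ t x, Φ t ((x, 0), 0) ∈ N →
      (W (Φ t ((x, 0), 0))).1 = F (Φ t ((x, 0), 0)).1 := fun t x ht => by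
    rw [h.eq _ ht, hF]
    exact congrArg X (Prod.ext rfl (h.param t ((x, 0), 0)))
  have hfneg' : ∀ t ∈ Ioo 0 s, f ((x₀, 0), t) < 0 := fun t ht => by
    have := hfneg t ht
    rwa [hflow t (Ioo_subset_Icc_self ht)] at this
  have hfz' : f ((x₀, 0), s) = 0 := by
    rw [hflow s ⟨hs.le, le_rfl⟩] at hfz
    exact hfz
  -- The orbit lies below the line just after `0` and just before `s`, which gives weak signs at
  -- both ends; nonvanishing of `F₂` there makes them strict.
  have hd0 : fderiv ℝ f ((x₀, 0), 0) (0, 1) < 0 := by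
    rw [hfd']
    refine lt_of_le_of_ne (hasDerivAt_nonpos_of_eventually_le_right (hfd (x₀, 0) 0) ?_) ?_
    · filter_upwards [Ioo_mem_nhdsGT hs] with t ht
      rw [hf0]
      exact (hfneg' t ht).le
    · rw [hι0, hWF 0 x₀ (hΦN 0 ⟨le_rfl, hs.le⟩), h.flow.zero]
      exact hne
  have hd1 : 0 < fderiv ℝ f ((x₀, 0), s) (0, 1) := by
    rw [hfd']
    refine lt_of_le_of_ne (hasDerivAt_nonneg_of_eventually_le_left (hfd (x₀, 0) s) ?_) ?_
    · filter_upwards [Ioo_mem_nhdsLT hs] with t ht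
      rw [hfz']
      exact (hfneg' t ht).le
    · rw [hι0, hWF s x₀ (hΦN s ⟨hs.le, le_rfl⟩), ← hflow s ⟨hs.le, le_rfl⟩]
      exact hft.symm
  obtain ⟨T, hTC, hT0, hT⟩ := exists_hit_time hfC hf0 hs hfneg' hfz' hd0 hd1
  have hΦT : ContDiffAt ℝ 2 (fun q => Φ (T q) (ι q)) (x₀, 0) :=
    h.smooth.contDiffAt.comp (x₀, (0 : ℝ)) (hTC.prodMk hιC.contDiffAt)
  set P : ℝ × ℝ → ℝ := fun q => (Φ (T q) (ι q)).1.1 with hP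
  have hPC : ContDiffAt ℝ 2 P (x₀, 0) :=
    contDiff_fst.contDiffAt.comp _ (contDiff_fst.contDiffAt.comp _ hΦT)
  -- Perturbed orbits must stay in `N`, where the cut-off field is the true one, up to their own
  -- hitting time, which may exceed `s`.
  have hmem : ∀ᶠ q in 𝓝 (x₀, (0 : ℝ)), ∀ t ∈ Icc 0 (s + 1), t ≤ T q → Φ t (ι q) ∈ N := by
    refine isCompact_Icc.eventually_forall_of_forall_eventually
      (P := fun q t => t ≤ T q → Φ t (ι q) ∈ N) fun τ hτ => ?_
    rcases le_or_gt τ s with hτs | hτs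
    · have hc : Continuous fun a : (ℝ × ℝ) × ℝ => Φ a.2 (ι a.1) :=
        h.continuous.comp (continuous_snd.prodMk (hιC.continuous.comp continuous_fst))
      filter_upwards [hc.continuousAt.eventually (h.isOpen.mem_nhds (hΦN τ ⟨hτ.1, hτs⟩))]
        with a ha _
      exact ha
    · obtain ⟨m, hm1, hm2⟩ := exists_between hτs
      have h1 : Tendsto (fun a : (ℝ × ℝ) × ℝ => T a.1) (𝓝 ((x₀, 0), τ)) (𝓝 s) := by
        rw [← hT0]
        exact hTC.continuousAt.tendsto.comp continuousAt_fst
      have h2 : Tendsto (fun a : (ℝ × ℝ) × ℝ => a.2) (𝓝 ((x₀, 0), τ)) (𝓝 τ) := continuousAt_snd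
      filter_upwards [h1.eventually (gt_mem_nhds hm1), h2.eventually (lt_mem_nhds hm2)]
        with a h3 h4 h5
      linarith
  have hTs : ∀ᶠ q in 𝓝 (x₀, (0 : ℝ)), T q < s + 1 :=
    hTC.continuousAt.eventually (gt_mem_nhds (by rw [hT0]; linarith))
  have hmem' : ∀ᶠ q in 𝓝 (x₀, (0 : ℝ)), ∀ t ∈ Icc 0 (T q), Φ t (ι q) ∈ N := by
    filter_upwards [hmem, hTs] with q h1 h2 t ht
    exact h1 t ⟨ht.1, ht.2.trans h2.le⟩ ht.2
  have hWc : Continuous W := h.smooth_field.continuous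
  have hneg0 : ∀ᶠ q in 𝓝 (x₀, (0 : ℝ)), (W (ι q)).1.2 < 0 := by
    have hc : Continuous fun q => (W (ι q)).1.2 := (hWc.comp hιC.continuous).fst.snd
    refine hc.continuousAt.eventually (gt_mem_nhds ?_)
    rwa [hfd', h.flow.zero] at hd0
  have hpos1 : ∀ᶠ q in 𝓝 (x₀, (0 : ℝ)), 0 < (W (Φ (T q) (ι q))).1.2 := by
    have hc : ContinuousAt (fun q => (W (Φ (T q) (ι q))).1.2) (x₀, 0) :=
      (hWc.continuousAt.comp hΦT.continuousAt).fst.snd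
    refine hc.eventually (lt_mem_nhds ?_)
    simp only [hT0]
    rwa [hfd'] at hd1
  have hend : ∀ q, f (q, T q) = 0 → (Φ (T q) (ι q)) = ((P q, 0), q.2) := fun q hq =>
    Prod.ext (Prod.ext rfl hq) (h.param _ _)
  have horb : ∀ᶠ q in 𝓝 (x₀, (0 : ℝ)), HalfOrbit X D q (T q) (P q) := by
    filter_upwards [hT, hmem', hneg0, hpos1] with q hTq hNq h0q h1q
    obtain ⟨hT1, hT2, hT3⟩ := hTq
    have hN0 : ι q ∈ N := by simpa [h.flow.zero] using hNq 0 ⟨le_rfl, hT1.le⟩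
    have hN1 := hNq (T q) ⟨hT1.le, le_rfl⟩
    refine ⟨hT1, ?_, ?_, fun t => (Φ t (ι q)).1, ?_, ?_, fun t ht => ⟨(hN (hNq t ht)).1,
      h.deriv_fst (hNq t ht)⟩, hT3⟩
    · rwa [h.eq _ hN0] at h0q
    · rwa [h.eq _ hN1, hend q hT2] at h1q
    · simp [h.flow.zero, hι]
    · simp [hend q hT2]
  refine ⟨T, P, hPC, horb, ?_⟩
  have hx : ContinuousAt (fun x : ℝ => (x, (0 : ℝ))) x₀ := by fun_prop
  have hTd : ∀ᶠ q in 𝓝 (x₀, (0 : ℝ)), ContDiffAt ℝ 2 T q := hTC.eventually (by simp)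
  filter_upwards [hx.eventually hmem', hx.eventually hT.eventually_nhds, hx.eventually hTd]
    with x hNx hTx hTdx
  have hT1 := hTx.self_of_nhds
  have hN1 := hNx (T (x, 0)) ⟨hT1.1.le, le_rfl⟩
  have hVC := h.variation_of_constants hD hN hFD hF hT1.1.le hNx
  refine ⟨hVC.1, ?_⟩
  rw [← hVC.2]
  have hε : ContinuousAt (fun ε : ℝ => (x, ε)) 0 := by fun_prop
  obtain ⟨T', hT'⟩ : ∃ T', HasDerivAt (fun ε => T (x, ε)) T' 0 :=
    ⟨_, hasDerivAt_prodMk_right (hTdx.differentiableAt two_ne_zero)⟩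
  have hι' : HasDerivAt (fun ε => ι (x, ε)) (0, 1) 0 :=
    (hasDerivAt_const 0 (x, (0 : ℝ))).prodMk (hasDerivAt_id 0)
  have hc : HasDerivAt (fun ε => Φ (T (x, ε)) (ι (x, ε)))
      (T' • W (Φ (T (x, 0)) (ι (x, 0))) + V (T (x, 0)) (ι (x, 0)) (0, 1)) 0 := by
    have := (h.uncurry_hasFDerivAt (T (x, 0)) (ι (x, 0))).comp_hasDerivAt
      (f := fun ε => (T (x, ε), ι (x, ε))) 0 (hT'.prodMk hι')
    simpa [Function.comp_def] using this
  have hW1 : (W (Φ (T (x, 0)) (ι (x, 0)))).1 = F (P (x, 0), 0) := by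
    rw [hι0, hWF _ _ hN1, ← hι0, hend _ hT1.2.1]
  have hc1 := hasDerivAt_fst hc
  have hcx := hasDerivAt_fst hc1
  have hcy := hasDerivAt_snd hc1
  -- Differentiating the landing condition gives `T' F₂ + V₂ = 0`. Substituted into `p' = T' F₁ +
  -- V₁` multiplied by `F₂`, it leaves `F₂ V₁ - F₁ V₂`, minus the wedge.
  have hy0 : (fun ε => (Φ (T (x, ε)) (ι (x, ε))).1.2) =ᶠ[𝓝 0] fun _ => 0 := by
    filter_upwards [hε.eventually hTx] with ε hε
    exact hε.2.1
  have hy := (hcy.congr_of_eventuallyEq hy0.symm).unique (hasDerivAt_const 0 (0 : ℝ))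
  refine ⟨_, hcx, ?_⟩
  simp only [Prod.fst_add, Prod.smul_fst, Prod.snd_add, Prod.smul_snd, smul_eq_mul, hW1] at hy ⊢
  rw [hι0] at hy ⊢
  simp only [wedge]
  linear_combination (F (P (x, 0), 0)).1 * hy

/-! ### Closing two half-orbits into a periodic solution -/

/-- Gluing a lower and an upper half-orbit, transversal to the switching line in the same
direction, into a crossing periodic solution. -/
theorem exists_isCrossingPeriodicSolution {D : Set (ℝ × ℝ)} {Xp Xm : ℝ → ℝ × ℝ → ℝ × ℝ}
    {A B : ℝ × ℝ → ℝ × ℝ} (hA : ∀ t, ∀ z ∈ D, z.2 ≤ 0 → Xm t z = A z)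
    (hB : ∀ t, ∀ z ∈ D, 0 ≤ z.2 → Xp t z = B z) {x P T₁ T₂ : ℝ} (hT₁ : 0 < T₁) (hT₂ : 0 < T₂)
    {u₁ u₂ : ℝ → ℝ × ℝ} (h₁0 : u₁ 0 = (x, 0)) (h₁T : u₁ T₁ = (P, 0))
    (h₁ : ∀ t ∈ Icc 0 T₁, u₁ t ∈ D ∧ HasDerivAt u₁ (A (u₁ t)) t)
    (h₁neg : ∀ t ∈ Ioo 0 T₁, (u₁ t).2 < 0) (h₂0 : u₂ 0 = (P, 0)) (h₂T : u₂ T₂ = (x, 0))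
    (h₂ : ∀ t ∈ Icc 0 T₂, u₂ t ∈ D ∧ HasDerivAt u₂ (B (u₂ t)) t)
    (h₂pos : ∀ t ∈ Ioo 0 T₂, 0 < (u₂ t).2) (hAx : (A (x, 0)).2 < 0) (hBx : (B (x, 0)).2 < 0)
    (hAP : 0 < (A (P, 0)).2) (hBP : 0 < (B (P, 0)).2) :
    ∃ u, IsCrossingPeriodicSolution D Xp Xm u ∧ u 0 = (x, 0) := by
  set T := T₁ + T₂ with hT
  have hTpos : 0 < T := by positivity
  set v : ℝ → ℝ × ℝ := fun t => if t ≤ T₁ then u₁ t else u₂ (t - T₁) with hv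
  set u : ℝ → ℝ × ℝ := fun t => v (toIcoMod hTpos 0 t) with hu
  have hper : Function.Periodic u T := fun t => by simp [hu]
  have hbase : ∀ t ∈ Ico 0 T, u t = v t := fun t ht => by
    simp only [hu]
    rw [(toIcoMod_eq_self hTpos).2 (by simpa using ht)]
  have hu1 : ∀ (n : ℤ), ∀ t, t - n * T ∈ Icc 0 T₁ → u t = u₁ (t - n * T) := fun n t ht => by
    rw [← hper.sub_int_mul_eq n, hbase _ ⟨ht.1, by linarith [ht.2]⟩]
    simp [hv, ht.2]
  -- The right endpoint already belongs to the next period, where `u` starts with `u₁`; the two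
  -- values agree because `u₂` ends where `u₁` begins.
  have hu2 : ∀ (n : ℤ), ∀ t, t - n * T - T₁ ∈ Icc 0 T₂ → u t = u₂ (t - n * T - T₁) :=
    fun n t ht => by
    rcases ht.2.eq_or_lt with h | h
    · have := hu1 (n + 1) t (by push_cast; constructor <;> linarith)
      rw [this, h, h₂T, ← h₁0]
      congr 1
      push_cast
      linarith
    rw [← hper.sub_int_mul_eq n, hbase _ ⟨by linarith [ht.1], by linarith⟩]
    rcases ht.1.eq_or_lt with h' | h'
    · have e : t - n * T = T₁ := by linarith
      simp [hv, e, h₁T, h₂0]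
    · have e : ¬ t - n * T ≤ T₁ := by linarith
      simp [hv, e]
  have hd1 : ∀ (n : ℤ) (t : ℝ), t - n * T ∈ Icc 0 T₁ →
      HasDerivAt (fun s => u₁ (s - n * T)) (A (u t)) t := fun n t ht => by
    rw [hu1 n t ht]
    exact (h₁ _ ht).2.comp_sub_const t (n * T)
  have hd2 : ∀ (n : ℤ) (t : ℝ), t - n * T - T₁ ∈ Icc 0 T₂ →
      HasDerivAt (fun s => u₂ (s - n * T - T₁)) (B (u t)) t := fun n t ht => by
    rw [hu2 n t ht]
    have := (h₂ _ ht).2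
    rw [sub_sub] at this ⊢
    simpa [sub_sub] using this.comp_sub_const t (n * T + T₁)
  have hlow : ∀ (n : ℤ) (t : ℝ), t - n * T ∈ Ioo 0 T₁ → HasDerivAt u (A (u t)) t :=
    fun n t ht => by
    refine (hd1 n t (Ioo_subset_Icc_self ht)).congr_of_eventuallyEq ?_
    filter_upwards [Ioo_mem_nhds (a := n * T) (b := n * T + T₁) (by linarith [ht.1])
      (by linarith [ht.2])] with s hs
    exact hu1 n s ⟨by linarith [hs.1], by linarith [hs.2]⟩
  have hupp : ∀ (n : ℤ) (t : ℝ), t - n * T - T₁ ∈ Ioo 0 T₂ → HasDerivAt u (B (u t)) t :=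
    fun n t ht => by
    refine (hd2 n t (Ioo_subset_Icc_self ht)).congr_of_eventuallyEq ?_
    filter_upwards [Ioo_mem_nhds (a := n * T + T₁) (b := n * T + T₁ + T₂) (by linarith [ht.1])
      (by linarith [ht.2])] with s hs
    exact hu2 n s ⟨by linarith [hs.1], by linarith [hs.2]⟩
  have h1r : ∀ (n : ℤ) (t : ℝ), t - n * T ∈ Ico 0 T₁ → HasDerivWithinAt u (A (u t)) (Ici t) t :=
    fun n t ht => by
    refine (hd1 n t (Ico_subset_Icc_self ht)).hasDerivWithinAt.congr_of_eventuallyEq ?_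
      (hu1 n t (Ico_subset_Icc_self ht))
    filter_upwards [Icc_mem_nhdsGE (show t < n * T + T₁ by linarith [ht.2])] with s hs
    exact hu1 n s ⟨by linarith [hs.1, ht.1], by linarith [hs.2]⟩
  have h1l : ∀ (n : ℤ) (t : ℝ), t - n * T ∈ Ioc 0 T₁ → HasDerivWithinAt u (A (u t)) (Iic t) t :=
    fun n t ht => by
    refine (hd1 n t (Ioc_subset_Icc_self ht)).hasDerivWithinAt.congr_of_eventuallyEq ?_
      (hu1 n t (Ioc_subset_Icc_self ht))
    filter_upwards [Icc_mem_nhdsLE (a := n * T) (b := t) (by linarith [ht.1])] with s hs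
    exact hu1 n s ⟨by linarith [hs.1], by linarith [hs.2, ht.2]⟩
  have h2r : ∀ (n : ℤ) (t : ℝ), t - n * T - T₁ ∈ Ico 0 T₂ →
      HasDerivWithinAt u (B (u t)) (Ici t) t := fun n t ht => by
    refine (hd2 n t (Ico_subset_Icc_self ht)).hasDerivWithinAt.congr_of_eventuallyEq ?_
      (hu2 n t (Ico_subset_Icc_self ht))
    filter_upwards [Icc_mem_nhdsGE (show t < n * T + T₁ + T₂ by linarith [ht.2])] with s hs
    exact hu2 n s ⟨by linarith [hs.1, ht.1], by linarith [hs.2]⟩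
  have h2l : ∀ (n : ℤ) (t : ℝ), t - n * T - T₁ ∈ Ioc 0 T₂ →
      HasDerivWithinAt u (B (u t)) (Iic t) t := fun n t ht => by
    refine (hd2 n t (Ioc_subset_Icc_self ht)).hasDerivWithinAt.congr_of_eventuallyEq ?_
      (hu2 n t (Ioc_subset_Icc_self ht))
    filter_upwards [Icc_mem_nhdsLE (a := n * T + T₁) (b := t) (by linarith [ht.1])] with s hs
    exact hu2 n s ⟨by linarith [hs.1], by linarith [hs.2, ht.2]⟩
  have hcases : ∀ t, u t ∈ D ∧
      (((u t).2 < 0 ∧ HasDerivAt u (A (u t)) t) ∨ (0 < (u t).2 ∧ HasDerivAt u (B (u t)) t) ∨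
      (u t = (x, 0) ∧ HasDerivWithinAt u (B (u t)) (Iic t) t ∧
        HasDerivWithinAt u (A (u t)) (Ici t) t) ∨
      (u t = (P, 0) ∧ HasDerivWithinAt u (A (u t)) (Iic t) t ∧
        HasDerivWithinAt u (B (u t)) (Ici t) t)) := fun t => by
    obtain ⟨n, hn⟩ : ∃ n : ℤ, t - n * T ∈ Ico 0 T := by
      refine ⟨toIcoDiv hTpos 0 t, ?_⟩
      have := sub_toIcoDiv_zsmul_mem_Ico hTpos 0 t
      simpa using this
    rcases le_or_gt (t - n * T) T₁ with hle | hgt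
    · have hmem : t - n * T ∈ Icc 0 T₁ := ⟨hn.1, hle⟩
      have huD : u t ∈ D := by rw [hu1 n t hmem]; exact (h₁ _ hmem).1
      refine ⟨huD, ?_⟩
      rcases hn.1.eq_or_lt with h0 | h0
      · refine Or.inr (Or.inr (Or.inl ⟨by rw [hu1 n t hmem, ← h0, h₁0], ?_,
          h1r n t ⟨hn.1, by linarith⟩⟩))
        -- At the start of a period the left derivative comes from the upper arc of the previous
        -- one.
        refine h2l (n - 1) t ?_
        push_cast
        constructor <;> linarith
      rcases hle.eq_or_lt with h1 | h1
      · refine Or.inr (Or.inr (Or.inr ⟨by rw [hu1 n t hmem, h1, h₁T], h1l n t ⟨h0, hle⟩,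
          h2r n t ⟨by linarith, by linarith⟩⟩))
      · exact Or.inl ⟨by rw [hu1 n t hmem]; exact h₁neg _ ⟨h0, h1⟩, hlow n t ⟨h0, h1⟩⟩
    · have hmem : t - n * T - T₁ ∈ Ioo 0 T₂ := ⟨by linarith, by linarith [hn.2]⟩
      have hmem' := Ioo_subset_Icc_self hmem
      refine ⟨by rw [hu2 n t hmem']; exact (h₂ _ hmem').1, Or.inr (Or.inl ⟨?_, hupp n t hmem⟩)⟩
      rw [hu2 n t hmem']
      exact h₂pos _ hmem
  have hu0 : u 0 = (x, 0) := by
    have := hu1 0 0 (by simpa using hT₁.le)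
    simpa [h₁0] using this
  have hXm : ∀ t, (u t).2 ≤ 0 → Xm t (u t) = A (u t) := fun t ht => hA t _ (hcases t).1 ht
  have hXp : ∀ t, 0 ≤ (u t).2 → Xp t (u t) = B (u t) := fun t ht => hB t _ (hcases t).1 ht
  refine ⟨u, ⟨⟨fun t => (hcases t).1, fun t ht => ?_, fun t ht => ?_, fun t ht => ?_,
    fun t ht hp => ?_, fun t ht hp => ?_⟩, ⟨T, hTpos, hper⟩, 0, by rw [hu0]⟩, hu0⟩
  · rw [hXp t ht.le]
    rcases (hcases t).2 with h | h | h | h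
    · exact absurd h.1 ht.le.not_gt
    · exact h.2
    · simp [h.1] at ht
    · simp [h.1] at ht
  · rw [hXm t ht.le]
    rcases (hcases t).2 with h | h | h | h
    · exact h.2
    · exact absurd h.1 ht.le.not_gt
    · simp [h.1] at ht
    · simp [h.1] at ht
  · rw [hXm t ht.le, hXp t ht.ge]
    rcases (hcases t).2 with h | h | h | h
    · exact absurd ht h.1.ne
    · exact absurd ht h.1.ne'
    · rw [h.1]; exact mul_pos_of_neg_of_neg hBx hAx
    · rw [h.1]; exact mul_pos hBP hAP
  · rw [hXm t ht.le, hXp t ht.ge]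
    rw [hXp t ht.ge] at hp
    rcases (hcases t).2 with h | h | h | h
    · exact absurd ht h.1.ne
    · exact absurd ht h.1.ne'
    · rw [h.1] at hp; exact absurd hp hBx.not_gt
    · exact h.2
  · rw [hXm t ht.le, hXp t ht.ge]
    rw [hXp t ht.ge] at hp
    rcases (hcases t).2 with h | h | h | h
    · exact absurd ht h.1.ne
    · exact absurd ht h.1.ne'
    · exact h.2
    · rw [h.1] at hp; exact absurd hp hBP.not_gt

/-! ### The reflection and the perturbed fields -/

theorem R_R (z : ℝ × ℝ) : R (R z) = z := by simp [R]

/-- `R` as a continuous linear map. -/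
def reflection : ℝ × ℝ →L[ℝ] ℝ × ℝ :=
  (ContinuousLinearMap.fst ℝ ℝ ℝ).prod (-ContinuousLinearMap.snd ℝ ℝ ℝ)

theorem reflection_apply (z : ℝ × ℝ) : reflection z = R z := rfl

theorem contDiff_R {n : WithTop ℕ∞} : ContDiff ℝ n R := reflection.contDiff

/-- Points of the switching line are limits of points of the open half-plane along a vertical
segment; the sign of `c` selects the half-plane. -/
theorem eq_on_closed_half {D : Set (ℝ × ℝ)} (hD : IsOpen D) {g₁ g₂ : ℝ × ℝ → ℝ × ℝ}
    (h₁ : ContinuousOn g₁ D) (h₂ : ContinuousOn g₂ D) {c : ℝ} (hc : c ≠ 0)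
    (h : ∀ z ∈ D, 0 < c * z.2 → g₁ z = g₂ z) {z : ℝ × ℝ} (hz : z ∈ D) (hz0 : 0 ≤ c * z.2) :
    g₁ z = g₂ z := by
  rcases hz0.eq_or_lt with h0 | h0
  · have hz2 : z.2 = 0 := (mul_eq_zero.1 h0.symm).resolve_left hc
    have hγ : Tendsto (fun τ : ℝ => (z.1, c * τ)) (𝓝[>] 0) (𝓝 z) := by
      have : ContinuousAt (fun τ : ℝ => (z.1, c * τ)) 0 := by fun_prop
      have h3 := this.tendsto.mono_left (nhdsWithin_le_nhds (s := Ioi 0))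
      have e : (z.1, c * 0) = z := by rw [mul_zero, ← hz2]
      rwa [e] at h3
    refine tendsto_nhds_unique_of_eventuallyEq
      ((h₁.continuousAt (hD.mem_nhds hz)).tendsto.comp hγ)
      ((h₂.continuousAt (hD.mem_nhds hz)).tendsto.comp hγ) ?_
    filter_upwards [hγ.eventually (hD.mem_nhds hz), self_mem_nhdsWithin] with τ hτ hτ0
    refine h _ hτ ?_
    have : 0 < τ := hτ0
    have : 0 < c * c := mul_self_pos.2 hc
    show 0 < c * (c * τ)
    rw [← mul_assoc]
    positivity
  · exact h z hz h0

section Perturbed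

variable {D : Set (ℝ × ℝ)} {F : ℝ × ℝ → ℝ × ℝ} {G : ℝ → ℝ × ℝ → ℝ × ℝ}
  {H : ℝ → ℝ × ℝ → ℝ → ℝ × ℝ} {ε₀ : ℝ}

theorem perturbed_zero (t : ℝ) (z : ℝ × ℝ) : perturbed F G H 0 t z = F z := by
  simp [perturbed]

theorem contDiffOn_perturbed (hF : ContDiffOn ℝ 2 F D)
    (hG : ContDiffOn ℝ ∞ (fun p : ℝ × (ℝ × ℝ) => G p.1 p.2) (univ ×ˢ D))
    (hH : ContDiffOn ℝ ∞ (fun p : ℝ × (ℝ × ℝ) × ℝ => H p.1 p.2.1 p.2.2)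
      (univ ×ˢ D ×ˢ Ioo (-ε₀) ε₀)) (t : ℝ) :
    ContDiffOn ℝ 2 (fun p : (ℝ × ℝ) × ℝ => perturbed F G H p.2 t p.1) (D ×ˢ Ioo (-ε₀) ε₀) := by
  have h2 : (2 : WithTop ℕ∞) ≤ ∞ := ENat.LEInfty.out
  have hF' : ContDiffOn ℝ 2 (fun p : (ℝ × ℝ) × ℝ => F p.1) (D ×ˢ Ioo (-ε₀) ε₀) :=
    hF.comp contDiff_fst.contDiffOn fun p hp => hp.1
  have hG' : ContDiffOn ℝ 2 (fun p : (ℝ × ℝ) × ℝ => G t p.1) (D ×ˢ Ioo (-ε₀) ε₀) :=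
    (hG.of_le h2).comp (f := fun p : (ℝ × ℝ) × ℝ => (t, p.1))
      (contDiff_const.prodMk contDiff_fst).contDiffOn fun p hp => ⟨trivial, hp.1⟩
  have hH' : ContDiffOn ℝ 2 (fun p : (ℝ × ℝ) × ℝ => H t p.1 p.2) (D ×ˢ Ioo (-ε₀) ε₀) :=
    (hH.of_le h2).comp (f := fun p : (ℝ × ℝ) × ℝ => (t, p))
      (contDiff_const.prodMk contDiff_id).contDiffOn fun p hp => ⟨trivial, hp⟩
  exact (hF'.add (contDiff_snd.contDiffOn.smul hG')).add
    ((contDiff_snd.pow 2).contDiffOn.smul hH')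

theorem continuousOn_perturbed (hF : ContDiffOn ℝ 2 F D)
    (hG : ContDiffOn ℝ ∞ (fun p : ℝ × (ℝ × ℝ) => G p.1 p.2) (univ ×ˢ D))
    (hH : ContDiffOn ℝ ∞ (fun p : ℝ × (ℝ × ℝ) × ℝ => H p.1 p.2.1 p.2.2)
      (univ ×ˢ D ×ˢ Ioo (-ε₀) ε₀)) (t : ℝ) {ε : ℝ} (hε : ε ∈ Ioo (-ε₀) ε₀) :
    ContinuousOn (perturbed F G H ε t) D :=
  (contDiffOn_perturbed hF hG hH t).continuousOn.comp (f := fun z => (z, ε))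
    (by fun_prop) fun _ hz => ⟨hz, hε⟩

theorem hasDerivAt_perturbed (hD : IsOpen D) (hε₀ : 0 < ε₀)
    (hH : ContDiffOn ℝ ∞ (fun p : ℝ × (ℝ × ℝ) × ℝ => H p.1 p.2.1 p.2.2)
      (univ ×ˢ D ×ˢ Ioo (-ε₀) ε₀)) (t : ℝ) {z : ℝ × ℝ} (hz : z ∈ D) :
    HasDerivAt (fun ε => perturbed F G H ε t z) (G t z) 0 := by
  have hd : DifferentiableAt ℝ (fun p : ℝ × (ℝ × ℝ) × ℝ => H p.1 p.2.1 p.2.2) (t, z, 0) :=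
    (hH.contDiffAt ((isOpen_univ.prod (hD.prod isOpen_Ioo)).mem_nhds
      ⟨trivial, hz, by linarith, hε₀⟩)).differentiableAt (by simp)
  have hH' : DifferentiableAt ℝ (fun ε => H t z ε) 0 :=
    DifferentiableAt.comp (f := fun ε : ℝ => (t, z, ε)) (0 : ℝ) hd (by fun_prop)
  have h1 : HasDerivAt (fun ε : ℝ => ε • G t z) (G t z) 0 := by
    simpa using (hasDerivAt_id (0 : ℝ)).smul_const (G t z)
  have h2 : HasDerivAt (fun ε : ℝ => ε ^ 2 • H t z ε) 0 0 := by
    simpa using (hasDerivAt_pow 2 (0 : ℝ)).fun_smul hH'.hasDerivAt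
  have h3 : HasDerivAt (fun ε : ℝ => (F z + ε • G t z) + ε ^ 2 • H t z ε) (0 + G t z + 0) 0 :=
    ((hasDerivAt_const (0 : ℝ) (F z)).fun_add h1).fun_add h2
  simpa [perturbed] using h3

end Perturbed

/-- Since `e x = 0`, the slope of `e * b` at `x` is the slope of `e` times `b`, so continuity of `b`
suffices. -/
theorem hasDerivAt_mul_of_eq_zero {e b : ℝ → ℝ} {a x : ℝ} (he : HasDerivAt e a x) (he0 : e x = 0)
    (hb : ContinuousAt b x) : HasDerivAt (fun y => e y * b y) (a * b x) x := by
  rw [hasDerivAt_iff_tendsto_slope] at he ⊢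
  refine (he.mul (hb.tendsto.mono_left nhdsWithin_le_nhds)).congr fun y => ?_
  simp [slope_def_field, he0, div_mul_eq_mul_div]

theorem wedge_sub_right (a b c : ℝ × ℝ) : wedge a (b - c) = wedge a b - wedge a c := by
  simp only [wedge, Prod.fst_sub, Prod.snd_sub]
  ring

end TwoFold

/-! ### Displacement function and Melnikov function -/

open TwoFold

theorem mainTheorem2
    (D : Set (ℝ × ℝ)) (hD : IsOpen D) (hRD : ∀ z ∈ D, TwoFold.R z ∈ D)
    (F : ℝ × ℝ → ℝ × ℝ) (hF : ContDiffOn ℝ 2 F D)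
    (xi xv : ℝ) (h1 : TwoFold.FoldHyp F D xi xv) (h2 : TwoFold.ReturnHyp F D xi xv)
    (ε₀ : ℝ) (hε₀ : 0 < ε₀)
    (Gp Gm : ℝ → ℝ × ℝ → ℝ × ℝ) (Hp Hm : ℝ → ℝ × ℝ → ℝ → ℝ × ℝ)
    (hGp : ContDiffOn ℝ ∞ (fun p : ℝ × (ℝ × ℝ) => Gp p.1 p.2) (univ ×ˢ D))
    (hGm : ContDiffOn ℝ ∞ (fun p : ℝ × (ℝ × ℝ) => Gm p.1 p.2) (univ ×ˢ D))
    (hHp : ContDiffOn ℝ ∞ (fun p : ℝ × (ℝ × ℝ) × ℝ => Hp p.1 p.2.1 p.2.2)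
      (univ ×ˢ D ×ˢ Ioo (-ε₀) ε₀))
    (hHm : ContDiffOn ℝ ∞ (fun p : ℝ × (ℝ × ℝ) × ℝ => Hm p.1 p.2.1 p.2.2)
      (univ ×ˢ D ×ˢ Ioo (-ε₀) ε₀))
    (hauto : ∀ ε ∈ Ioo (-ε₀) ε₀, TwoFold.IsAutonomous D
      (TwoFold.perturbed (TwoFold.reversed F) Gp Hp ε) (TwoFold.perturbed F Gm Hm ε))
    (θ xs : ℝ) (hxs : xs ∈ Ioo xi xv)
    (hM : TwoFold.melnikov F D Gm Gp θ xs = 0)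
    (hM' : deriv (fun x => TwoFold.melnikov F D Gm Gp θ x) xs ≠ 0) :
    ∃ C : ℝ, 0 < C ∧ ∃ ε₁ ∈ Ioc 0 ε₀, ∀ ε ∈ Ioo 0 ε₁, ∃ u : ℝ → ℝ × ℝ,
      TwoFold.IsCrossingPeriodicSolution D
        (TwoFold.perturbed (TwoFold.reversed F) Gp Hp ε) (TwoFold.perturbed F Gm Hm ε) u ∧
      ‖u 0 - (xs, 0)‖ ≤ C * ε := by
  have hI0 : (0 : ℝ) ∈ Ioo (-ε₀) ε₀ := ⟨by linarith, hε₀⟩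
  have hRmaps : MapsTo R D D := hRD
  have hFr : ContDiffOn ℝ 2 (reversed F) D :=
    (contDiff_R.comp_contDiffOn (hF.comp contDiff_R.contDiffOn hRmaps)).neg
  -- the fields do not depend on time on the closed half-zones
  have hAm : ∀ ε ∈ Ioo (-ε₀) ε₀, ∀ s t, ∀ z ∈ D, z.2 ≤ 0 →
      perturbed F Gm Hm ε s z = perturbed F Gm Hm ε t z := fun ε hε s t z hz hz0 =>
    eq_on_closed_half hD (continuousOn_perturbed hF hGm hHm s hε)
      (continuousOn_perturbed hF hGm hHm t hε) (c := -1) (by norm_num)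
      (fun w hw hw0 => (hauto ε hε s t w hw).2 (by linarith)) hz (by linarith)
  have hAp : ∀ ε ∈ Ioo (-ε₀) ε₀, ∀ s t, ∀ z ∈ D, 0 ≤ z.2 →
      perturbed (reversed F) Gp Hp ε s z = perturbed (reversed F) Gp Hp ε t z :=
    fun ε hε s t z hz hz0 =>
    eq_on_closed_half hD (continuousOn_perturbed hFr hGp hHp s hε)
      (continuousOn_perturbed hFr hGp hHp t hε) (c := 1) (by norm_num)
      (fun w hw hw0 => (hauto ε hε s t w hw).1 (by linarith)) hz (by linarith)
  -- `G` is the `ε`-derivative of the field at `ε = 0`, so it inherits time independence on the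
  -- closed half-zone.
  have hGmt : ∀ s t, ∀ z ∈ D, z.2 ≤ 0 → Gm s z = Gm t z := fun s t z hz hz0 => by
    refine (hasDerivAt_perturbed (F := F) hD hε₀ hHm s hz).unique
      ((hasDerivAt_perturbed (F := F) hD hε₀ hHm t hz).congr_of_eventuallyEq ?_)
    filter_upwards [Ioo_mem_nhds hI0.1 hI0.2] with ε hε
    exact hAm ε hε s t z hz hz0
  have hGpt : ∀ s t, ∀ z ∈ D, 0 ≤ z.2 → Gp s z = Gp t z := fun s t z hz hz0 => by
    refine (hasDerivAt_perturbed (F := reversed F) hD hε₀ hHp s hz).unique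
      ((hasDerivAt_perturbed (F := reversed F) hD hε₀ hHp t hz).congr_of_eventuallyEq ?_)
    filter_upwards [Ioo_mem_nhds hI0.1 hI0.2] with ε hε
    exact hAp ε hε s t z hz hz0
  -- the lower field and the reflected, time-reversed upper field
  set X₁ : (ℝ × ℝ) × ℝ → ℝ × ℝ := fun p => perturbed F Gm Hm p.2 0 p.1 with hX₁
  set X₂ : (ℝ × ℝ) × ℝ → ℝ × ℝ :=
    fun p => -R (perturbed (reversed F) Gp Hp p.2 0 (R p.1)) with hX₂
  have hX₁C : ContDiffOn ℝ 2 X₁ (D ×ˢ Ioo (-ε₀) ε₀) := contDiffOn_perturbed hF hGm hHm 0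
  have hX₂C : ContDiffOn ℝ 2 X₂ (D ×ˢ Ioo (-ε₀) ε₀) := by
    refine (contDiff_R.comp_contDiffOn ?_).neg
    exact (contDiffOn_perturbed hFr hGp hHp 0).comp
      (f := fun p : (ℝ × ℝ) × ℝ => (R p.1, p.2))
      ((contDiff_R.comp contDiff_fst).prodMk contDiff_snd).contDiffOn
      fun p hp => ⟨hRD _ hp.1, hp.2⟩
  have hF₁ : ∀ z, F z = X₁ (z, 0) := fun z => (perturbed_zero 0 z).symm
  have hF₂ : ∀ z, F z = X₂ (z, 0) := fun z => by
    simp only [hX₂, perturbed_zero, reversed, R_R]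
    simp [R]
  have hOpen : IsOpen (D ×ˢ Ioo (-ε₀) ε₀) := hD.prod isOpen_Ioo
  have hg₁ : ∀ z ∈ D, fderiv ℝ X₁ (z, 0) (0, 1) = Gm 0 z := fun z hz =>
    (hasDerivAt_prodMk_right ((hX₁C.contDiffAt (hOpen.mem_nhds ⟨hz, hI0⟩)).differentiableAt
      two_ne_zero)).unique (hasDerivAt_perturbed hD hε₀ hHm 0 hz)
  have hg₂ : ∀ z ∈ D, fderiv ℝ X₂ (z, 0) (0, 1) = -R (Gp 0 (R z)) := fun z hz =>
    (hasDerivAt_prodMk_right ((hX₂C.contDiffAt (hOpen.mem_nhds ⟨hz, hI0⟩)).differentiableAt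
      two_ne_zero)).unique
      ((reflection.hasFDerivAt.comp_hasDerivAt (0 : ℝ)
        (hasDerivAt_perturbed (F := reversed F) hD hε₀ hHp 0 (hRD z hz))).neg)
  obtain ⟨s, hs⟩ := h2 xs (Ioo_subset_Ioc_self hxs)
  have hne := h1.ne_zero xs hxs
  obtain ⟨T₁, P₁, hP₁, horb₁, hder₁⟩ :=
    exists_halfReturn hD isOpen_Ioo hI0 hX₁C hF hF₁ hs hne
  obtain ⟨T₂, P₂, hP₂, horb₂, hder₂⟩ :=
    exists_halfReturn hD isOpen_Ioo hI0 hX₂C hF hF₂ hs hne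
  -- This compares the forward lower return with the backward upper return, so a zero closes the
  -- orbit without composing the two maps.
  set d : ℝ × ℝ → ℝ := fun q => P₁ q - P₂ q with hd
  have hdC : ContDiffAt ℝ 2 d (xs, 0) := hP₁.sub hP₂
  have hx : ContinuousAt (fun x : ℝ => (x, (0 : ℝ))) xs := by fun_prop
  have hP₁₂ : ∀ᶠ x in 𝓝 xs, P₁ (x, 0) = P₂ (x, 0) ∧ T₁ (x, 0) = T₂ (x, 0) ∧
      returnTime F D x = T₁ (x, 0) ∧ flow F D (T₁ (x, 0)) (x, 0) = (P₁ (x, 0), 0) ∧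
      0 < T₁ (x, 0) ∧
      ∀ t ∈ Icc 0 (T₁ (x, 0)), flow F D t (x, 0) ∈ D ∧ (flow F D t (x, 0)).2 ≤ 0 := by
    filter_upwards [hx.eventually horb₁, hx.eventually horb₂] with x ho₁ ho₂
    have hr₁ := returnTime_eq (ho₁.reachesAt hD hF hF₁)
    have hr₂ := returnTime_eq (ho₂.reachesAt hD hF hF₂)
    have hf₁ := ho₁.flow_mem hD hF hF₁
    have hf₂ := ho₂.flow_mem hD hF hF₂
    have hTT := hr₁.symm.trans hr₂
    refine ⟨?_, hTT, hr₁, hf₁.1, ho₁.1, hf₁.2⟩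
    have := hf₁.1
    rw [hTT, hf₂.1] at this
    exact (congrArg Prod.fst this).symm
  set e : ℝ → ℝ := fun x => fderiv ℝ d (x, 0) (0, 1) with he
  set b : ℝ → ℝ := fun x => (F (P₁ (x, 0), 0)).2 with hb
  -- The orbit lies in `y ≤ 0` and its reflection in `y ≥ 0`, exactly where `Gm` and `Gp` ignore
  -- time. The bracket is therefore the difference of the `ε`-derivatives of `X₁` and `X₂`, whatever
  -- `θ` is.
  have hMe : ∀ᶠ x in 𝓝 xs, melnikov F D Gm Gp θ x = -(e x * b x) := by
    filter_upwards [hP₁₂, hder₁, hder₂, hx.eventually (hdC.eventually (by simp))]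
      with x hPx hd₁ hd₂ hdx
    obtain ⟨hPP, hTT, hrt, hfl, hTpos, hfD⟩ := hPx
    obtain ⟨hi₁, p₁, hp₁, hp₁'⟩ := hd₁
    obtain ⟨hi₂, p₂, hp₂, hp₂'⟩ := hd₂
    have hex : e x = p₁ - p₂ :=
      (hasDerivAt_prodMk_right (hdx.differentiableAt two_ne_zero)).unique (hp₁.fun_sub hp₂)
    rw [← hTT] at hi₂ hp₂'
    rw [← hPP] at hp₂'
    have hint : (∫ t in (0 : ℝ)..T₁ (x, 0), (fundamental F D t (x, 0)).inverse
        (bracket Gm Gp θ t (flow F D t (x, 0)))) =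
        (∫ t in (0 : ℝ)..T₁ (x, 0), (fundamental F D t (x, 0)).inverse
          (fderiv ℝ X₁ (flow F D t (x, 0), 0) (0, 1))) -
        ∫ t in (0 : ℝ)..T₁ (x, 0), (fundamental F D t (x, 0)).inverse
          (fderiv ℝ X₂ (flow F D t (x, 0), 0) (0, 1)) := by
      rw [← intervalIntegral.integral_sub hi₁ hi₂]
      refine intervalIntegral.integral_congr fun t ht => ?_
      rw [uIcc_of_le hTpos.le] at ht
      obtain ⟨hD', hle⟩ := hfD t ht
      simp only [← map_sub]
      rw [hg₁ _ hD', hg₂ _ hD', bracket, hGmt (t + θ) 0 _ hD' hle,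
        hGpt (-t + θ) 0 _ (hRD _ hD') (by simpa [R] using hle), sub_neg_eq_add]
    rw [melnikov, hrt, hfl, hint, map_sub, wedge_sub_right, hex]
    linear_combination hp₁' - hp₂'
  have hbpos : 0 < b xs := by
    have := (hx.eventually horb₁).self_of_nhds.2.2.1
    rwa [← hF₁] at this
  have hbc : ContinuousAt b xs := by
    obtain ⟨-, -, -, hfl, hT, hfD⟩ := hP₁₂.self_of_nhds
    have hmem : (P₁ (xs, 0), (0 : ℝ)) ∈ D := by
      rw [← hfl]
      exact (hfD _ ⟨hT.le, le_rfl⟩).1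
    have hc : ContinuousAt (fun x : ℝ => (P₁ (x, 0), (0 : ℝ))) xs :=
      (ContinuousAt.comp (f := fun x : ℝ => (x, (0 : ℝ))) hP₁.continuousAt hx).prodMk
        continuousAt_const
    exact (ContinuousAt.comp (f := fun x : ℝ => (P₁ (x, 0), (0 : ℝ)))
      (hF.continuousOn.continuousAt (hD.mem_nhds hmem)) hc).snd
  have he0 : e xs = 0 := by
    have := hMe.self_of_nhds
    rw [hM] at this
    exact (mul_eq_zero.1 (neg_eq_zero.1 this.symm)).resolve_right hbpos.ne'
  have hed : DifferentiableAt ℝ e xs := by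
    have h3 : DifferentiableAt ℝ (fderiv ℝ d) (xs, 0) :=
      (hdC.fderiv_right (m := 1) (by norm_num)).differentiableAt one_ne_zero
    have h4 : DifferentiableAt ℝ (fun x : ℝ => fderiv ℝ d (x, 0)) xs :=
      DifferentiableAt.comp (f := fun x : ℝ => (x, (0 : ℝ))) xs h3 (by fun_prop)
    exact h4.clm_apply (differentiableAt_const _)
  have ha : deriv e xs ≠ 0 := fun ha => hM' <| by
    have h3 := (hasDerivAt_mul_of_eq_zero hed.hasDerivAt he0 hbc).fun_neg
    rw [ha, zero_mul, neg_zero] at h3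
    exact (h3.congr_of_eventuallyEq hMe).deriv
  obtain ⟨C, hC, ε₁, hε₁, hzero⟩ := exists_zero_of_simple_zero hdC
    (hP₁₂.mono fun x hx => sub_eq_zero.2 hx.1) he0 hed.hasDerivAt ha
  obtain ⟨r, hr, hball⟩ := Metric.eventually_nhds_iff_ball.1 (horb₁.and horb₂)
  -- The bounds `r` and `r / C` place `(x, ε)` in the ball on which both half-orbits exist.
  refine ⟨C, hC, min (min ε₁ ε₀) (min r (r / C)), ⟨by positivity,
    (min_le_left _ _).trans (min_le_right _ _)⟩, fun ε hε => ?_⟩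
  have hε1 : ε < ε₁ := hε.2.trans_le ((min_le_left _ _).trans (min_le_left _ _))
  have hε2 : ε < ε₀ := hε.2.trans_le ((min_le_left _ _).trans (min_le_right _ _))
  have hε3 : ε < r := hε.2.trans_le ((min_le_right _ _).trans (min_le_left _ _))
  have hε4 : C * ε < r := by
    have := hε.2.trans_le ((min_le_right _ _).trans (min_le_right _ _))
    rwa [lt_div_iff₀' hC] at this
  have hεI : ε ∈ Ioo (-ε₀) ε₀ := ⟨by linarith [hε.1], hε2⟩
  obtain ⟨x, hxC, hdx⟩ := hzero ε ⟨hε.1, hε1⟩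
  have hmem : (x, ε) ∈ ball (xs, (0 : ℝ)) r := by
    rw [mem_ball, Prod.dist_eq, max_lt_iff]
    simp only [Real.dist_eq, sub_zero, abs_of_pos hε.1]
    exact ⟨hxC.trans_lt hε4, hε3⟩
  obtain ⟨⟨hT₁, hAx, hAP, u₁, hu₁0, hu₁T, hu₁, hu₁neg⟩,
    ⟨hT₂, hBx, hBP, w, hw0, hwT, hw, hwneg⟩⟩ := hball _ hmem
  rw [← sub_eq_zero.1 hdx] at hBP hwT
  have hR0 : ∀ y : ℝ, R (y, 0) = (y, 0) := fun y => by simp [R]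
  have hX₂snd : ∀ y : ℝ, (X₂ ((y, 0), ε)).2 = (perturbed (reversed F) Gp Hp ε 0 (y, 0)).2 :=
    fun y => by
    simp only [hX₂, hR0]
    simp [R]
  -- The upper arc is the reflected half-orbit of `X₂` run backwards; it starts at the common
  -- landing point and ends at `(x, 0)`.
  obtain ⟨u, hu, hu0⟩ := exists_isCrossingPeriodicSolution
    (A := perturbed F Gm Hm ε 0) (B := perturbed (reversed F) Gp Hp ε 0)
    (fun t z hz hz0 => hAm ε hεI t 0 z hz hz0) (fun t z hz hz0 => hAp ε hεI t 0 z hz hz0)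
    hT₁ hT₂ hu₁0 hu₁T hu₁ hu₁neg (u₂ := fun t => R (w (T₂ (x, ε) - t)))
    (by simp only [sub_zero, hwT, hR0]) (by simp only [sub_self, hw0, hR0])
    (fun t ht => by
      have ht' : T₂ (x, ε) - t ∈ Icc 0 (T₂ (x, ε)) := ⟨by linarith [ht.2], by linarith [ht.1]⟩
      refine ⟨hRD _ (hw _ ht').1, ?_⟩
      have h3 := reflection.hasFDerivAt.comp_hasDerivAt t
        ((hw _ ht').2.scomp t ((hasDerivAt_id t).const_sub (T₂ (x, ε))))
      have h4 : reflection ((-1 : ℝ) • X₂ (w (T₂ (x, ε) - t), ε)) =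
          perturbed (reversed F) Gp Hp ε 0 (R (w (T₂ (x, ε) - t))) := by
        simp [hX₂, reflection_apply, R_R]
      rw [← h4]
      exact h3)
    (fun t ht => by
      have := hwneg (T₂ (x, ε) - t) ⟨by linarith [ht.2], by linarith [ht.1]⟩
      simpa [R] using this)
    hAx (by rw [← hX₂snd]; exact hBx) hAP (by rw [← hX₂snd]; exact hBP)
  refine ⟨u, hu, ?_⟩
  rw [hu0]
  simpa [Prod.norm_def] using hxC
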